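/- **Proposition 4.1.** Let $n\ge 2$ and $k\in\mathbb N\cup\{\infty\}$. Let $U\subset\mathbb R^{n+1}$ be an open neighbourhood of the origin $O$, star-shaped about $O$, with coordinates $y^0,\dots,y^n$, and let $C$ be a Lorentzian metric on $U$, with components of class $C^{k+1}$, for which the $y^\mu$ are normal coordinates centred at $O$; that is, $C(O)=\eta=\mathrm{diag}(-1,1,\dots,1)$ and the straight lines through $O$ are affinely parametrized geodesics of $C$. Let $C_O=\{y^0=|\vec y|\}$ be the future light-cone of $O$. Off its vertex, parametrize it by $y^0=r$, $y^i=r\Theta^i(x^A)$, where $r>0$ and the $x^A$ are local coordinates on the sphere $S^{n-1}=\{\sum_i(\Theta^i)^2=1\}$. Write $\partial_1=\partial_r$ at fixed $x^A$, let $s_{AB}=\sum_i\partial_A\Theta^i\,\partial_B\Theta^i$ be the round metric of $S^{n-1}$, and let $$\gamma_{AB}=r^2\sum_{i,j=1}^n C_{ij}|_{C_O}\,\partial_A\Theta^i\,\partial_B\Theta^j$$ be the tensor induced by $C$ on $C_O$. Let $\kappa$ be a function on $(C_O\cap U)\setminus\{O\}$ such that $r\kappa$ is the restriction to $C_O$ of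 a function $K$ of class $C^k$ on $U$ with $K(y)=O(|y|^2)$ as $y\to O$. For a positive function $\Omega$ put $\overline g_{AB}=\Omega^2\gamma_{AB}$, let $\overline g^{AB}$ be the inverse matrix, $\tau=\tfrac12\overline g^{AB}\partial_1\overline g_{AB}$ and $\varphi=(\det\overline g_{AB}/\det s_{AB})^{1/(2n-2)}$, and let $|\sigma|^2=\sigma_A{}^B\sigma_B{}^A$, where $\sigma_A{}^C$ is the traceless part of $\tfrac12\gamma^{BC}\partial_1\gamma_{AB}$. For an open neighbourhood $V\subset U$ of $O$ that is star-shaped about $O$, call $\Omega>0$ on $(C_O\cap V)\setminus\{O\}$ a *conformal factor on $V$* if it solves the vacuum Raychaudhuri equation $$\partial_1\tau-\kappa\tau+\frac{\tau^2}{n-1}+|\sigma|^2=0$$ there and tends to $1$ at the vertex along every generator of $C_O$. Then a conformal factor exists on some such $V$. Moreover, for every such $V$ and every conformal factor $\Omega$ on $V$, the equation $$\partial_1\nu^0=-\Big(\frac\tau2+\kappa\Big)\nu^0+\frac12\,\overline g^{AB}\,r\,s_{AB}\qquad\text{on }(C_O\cap V)\setminus\{O\}$$ has exactly one solution $\nu^0$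 satisfying $\nu^0\varphi^{(n-1)/2}\to0$ as $r\to0$ along every generator. This solution has no zeros, and $\nu_0=1/\nu^0$ is the restriction to $(C_O\cap V)\setminus\{O\}$ of a function of class $C^k$ on $V$ which equals $1$ at the vertex $O$. -/

import Mathlib

open Filter Topology Set

noncomputable section

namespace LightCone

/-- The coordinate space `ℝⁿ⁺¹` with coordinates `y⁰, y¹, …, yⁿ`. -/
abbrev Spacetime (n : ℕ) := EuclideanSpace ℝ (Fin (n + 1))

/-- Matrix of covariant components `C_{μν}` in the coordinates `y^μ`. -/
abbrev Form (n : ℕ) := Matrix (Fin (n + 1)) (Fin (n + 1)) ℝ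

/-- `η = diag (-1, 1, …, 1)`. -/
def minkowski (n : ℕ) : Form n :=
  Matrix.diagonal (Fin.cons (-1) (fun _ : Fin n => 1))

/-- A bilinear form of signature `(-, +, …, +)`: its matrix is `η` in a suitable basis
(the columns of `P`). In particular it is symmetric and nondegenerate. -/
def IsLorentzian {n : ℕ} (B : Form n) : Prop :=
  ∃ P : Form n, IsUnit P.det ∧ P.transpose * B * P = minkowski n

/-- `∂_μ h` at `y`. -/
def pd {n : ℕ} (μ : Fin (n + 1)) (h : Spacetime n → ℝ) (y : Spacetime n) : ℝ :=
  fderiv ℝ h y (EuclideanSpace.single μ 1)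

/-- Christoffel symbols `Γ^l_{μν}` of the metric `C` in the coordinates `y`. -/
def christoffel {n : ℕ} (C : Spacetime n → Form n) (y : Spacetime n)
    (l μ ν : Fin (n + 1)) : ℝ :=
  (1 / 2) * ∑ ρ, (C y)⁻¹ l ρ *
    (pd μ (fun z => C z ρ ν) y + pd ν (fun z => C z ρ μ) y - pd ρ (fun z => C z μ ν) y)

/-- An open star-shaped neighbourhood of the vertex `O = 0`. -/
structure IsStarNhd {n : ℕ} (U : Set (Spacetime n)) : Prop where
  isOpen : IsOpen U
  zero_mem : (0 : Spacetime n) ∈ U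
  star : StarConvex ℝ 0 U

/-- The coordinates `y^μ` on `U` are normal coordinates of `C` centred at `0`: the coordinate
basis is orthonormal at `0`, and every straight line `t ↦ t y` is an affinely parametrized
geodesic (in `U` the geodesic equation along these lines is `Γ^l_{μν}(y) y^μ y^ν = 0`). -/
structure IsNormal {n : ℕ} (C : Spacetime n → Form n) (U : Set (Spacetime n)) : Prop where
  at_zero : C 0 = minkowski n
  radial : ∀ y ∈ U, ∀ l, ∑ μ, ∑ ν, christoffel C y l μ ν * y μ * y ν = 0

/-- The future light-cone `C_O = {y⁰ = |(y¹, …, yⁿ)|}` of the vertex. -/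
def cone (n : ℕ) : Set (Spacetime n) :=
  {y | y 0 = Real.sqrt (∑ i : Fin n, y i.succ ^ 2)}

/-- The vector `(1, θ)`; for a unit vector `θ`, `r ↦ r • gen θ` is the generator of `C_O` in the
direction `θ`, i.e. the point with `x¹ = r` and `Θ^i(x^A) = θ^i`. -/
def gen {n : ℕ} (θ : EuclideanSpace ℝ (Fin n)) : Spacetime n :=
  WithLp.toLp 2 (Fin.cons 1 (fun i => θ i))

/-- `e_A`, `A = 1, …, n-1`, is a basis of the tangent space of `S^{n-1}` at `θ`
(such as the coordinate basis `∂Θ/∂x^A` of a local coordinate system of the sphere). -/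
def IsTangentFrame {n : ℕ} (θ : EuclideanSpace ℝ (Fin n))
    (e : Fin (n - 1) → EuclideanSpace ℝ (Fin n)) : Prop :=
  LinearIndependent ℝ e ∧ ∀ A, inner ℝ (e A) θ = 0

section Angular

variable {n : ℕ}

/-- Matrices of angular components, indices `A, B`. -/
abbrev AForm (n : ℕ) := Matrix (Fin (n - 1)) (Fin (n - 1)) ℝ

/-- `s_{AB}`, the unit round metric of `S^{n-1}`. -/
def roundMetric (e : Fin (n - 1) → EuclideanSpace ℝ (Fin n)) : AForm n :=
  Matrix.of fun A B => ∑ i, e A i * e B i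

/-- `γ_{AB} = C_{AB}` restricted to the cone, `C_{AB} = r² C_{ij} (∂Θ^i/∂x^A) (∂Θ^j/∂x^B)`,
as a function of `r` along the generator in the direction `θ`. -/
def gam (C : Spacetime n → Form n) (θ : EuclideanSpace ℝ (Fin n))
    (e : Fin (n - 1) → EuclideanSpace ℝ (Fin n)) (r : ℝ) : AForm n :=
  Matrix.of fun A B =>
    r ^ 2 * ∑ i : Fin n, ∑ j : Fin n, C (r • gen θ) i.succ j.succ * e A i * e B j

/-- `g_{AB} = Ω² γ_{AB}`. -/
def gbar (C : Spacetime n → Form n) (Ω : Spacetime n → ℝ) (θ : EuclideanSpace ℝ (Fin n))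
    (e : Fin (n - 1) → EuclideanSpace ℝ (Fin n)) (r : ℝ) : AForm n :=
  Ω (r • gen θ) ^ 2 • gam C θ e r

/-- `∂₁ h_{AB}`. -/
def dr (h : ℝ → AForm n) (r : ℝ) : AForm n :=
  Matrix.of fun A B => deriv (fun s => h s A B) r

/-- The divergence `½ h^{AB} ∂₁ h_{AB}`. -/
def divergence (h : ℝ → AForm n) (r : ℝ) : ℝ :=
  (1 / 2) * ∑ A, ∑ B, (h r)⁻¹ A B * dr h r A B

/-- `σ_A^C`, the traceless part of `½ h^{BC} ∂₁ h_{AB}`. -/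
def shear (h : ℝ → AForm n) (r : ℝ) : AForm n :=
  (1 / 2 : ℝ) • (dr h r * (h r)⁻¹) -
    (((1 / 2 : ℝ) • (dr h r * (h r)⁻¹)).trace / ((n : ℝ) - 1)) • (1 : AForm n)

/-- `|σ|² = σ_A^B σ_B^A`. -/
def shearSq (h : ℝ → AForm n) (r : ℝ) : ℝ :=
  ∑ A, ∑ B, shear h r A B * shear h r B A

/-- `φ = (det g_{AB} / det s_{AB})^{1/(2n-2)}`. -/
def phi (C : Spacetime n → Form n) (Ω : Spacetime n → ℝ) (θ : EuclideanSpace ℝ (Fin n))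
    (e : Fin (n - 1) → EuclideanSpace ℝ (Fin n)) (r : ℝ) : ℝ :=
  ((gbar C Ω θ e r).det / (roundMetric e).det) ^ (1 / (2 * (n : ℝ) - 2))

/-- `Ω` (of which only the values on `C_O ∩ V`, off the vertex, matter) is the conformal factor:
it is positive, tends to one at the vertex, and the divergence `τ` of `g_{AB} = Ω² γ_{AB}` solves
the vacuum Raychaudhuri equation `∂₁τ - κ τ + τ²/(n-1) + |σ|² = 0` on `C_O ∩ V`. -/
structure IsConformalFactor (C : Spacetime n → Form n) (κ : Spacetime n → ℝ)
    (V : Set (Spacetime n)) (Ω : Spacetime n → ℝ) : Prop where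
  pos : ∀ θ : EuclideanSpace ℝ (Fin n), ‖θ‖ = 1 → ∀ r : ℝ, 0 < r → r • gen θ ∈ V →
    0 < Ω (r • gen θ)
  diff : ∀ θ : EuclideanSpace ℝ (Fin n), ‖θ‖ = 1 → ∀ r : ℝ, 0 < r → r • gen θ ∈ V →
    DifferentiableAt ℝ (fun s : ℝ => Ω (s • gen θ)) r
  vertex : ∀ θ : EuclideanSpace ℝ (Fin n), ‖θ‖ = 1 →
    Tendsto (fun s : ℝ => Ω (s • gen θ)) (𝓝[>] 0) (𝓝 1)
  raychaudhuri : ∀ θ : EuclideanSpace ℝ (Fin n), ‖θ‖ = 1 → ∀ e, IsTangentFrame θ e →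
    ∀ r : ℝ, 0 < r → r • gen θ ∈ V →
      ∃ dτ : ℝ, HasDerivAt (divergence (gbar C Ω θ e)) dτ r ∧
        dτ - κ (r • gen θ) * divergence (gbar C Ω θ e) r
          + divergence (gbar C Ω θ e) r ^ 2 / ((n : ℝ) - 1) + shearSq (gam C θ e) r = 0

/-- `N` (of which only the values on `C_O ∩ V`, off the vertex, matter) is the function `ν⁰`: it
solves `∂₁ν⁰ = -(τ/2 + κ) ν⁰ + ½ g^{AB} r s_{AB}` on `C_O ∩ V`, with the boundary condition
`ν⁰ φ^{(n-1)/2} → 0` at the vertex. -/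
structure IsNuUpper (C : Spacetime n → Form n) (κ Ω : Spacetime n → ℝ)
    (V : Set (Spacetime n)) (N : Spacetime n → ℝ) : Prop where
  ode : ∀ θ : EuclideanSpace ℝ (Fin n), ‖θ‖ = 1 → ∀ e, IsTangentFrame θ e →
    ∀ r : ℝ, 0 < r → r • gen θ ∈ V →
      HasDerivAt (fun s : ℝ => N (s • gen θ))
        (-(divergence (gbar C Ω θ e) r / 2 + κ (r • gen θ)) * N (r • gen θ)
          + (1 / 2) * ∑ A, ∑ B, (gbar C Ω θ e r)⁻¹ A B * (r * roundMetric e A B)) r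
  vertex : ∀ θ : EuclideanSpace ℝ (Fin n), ‖θ‖ = 1 → ∀ e, IsTangentFrame θ e →
    Tendsto (fun s : ℝ => N (s • gen θ) * phi C Ω θ e s ^ (((n : ℝ) - 1) / 2))
      (𝓝[>] 0) (𝓝 0)

end Angular

end LightCone

end

set_option linter.unusedSectionVars false

/-! The Raychaudhuri equation is linear in disguise. If φ is the area radius of Ω²γ, then τ = (n-1)
φ'/φ, the shear depends only on the conformal class of γ, and the equation reads φ'' = κ φ' - b φ
with b = |σ|²/(n-1). The normalization φ/r → 1 alone selects one solution (`eq_of_second_order`).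
Hence all conformal factors come from the same function, and positivity of Ω forces that function to
be positive on the whole cone inside V.

The difficulty is regularity at the vertex, where angular coordinates break down. By the Gauss lemma
(`gauss_lemma`) the generators are null for C and orthogonal to the angular directions, so C⁻¹
splits into an angular block and a null block (`exists_inverse_decomposition`). The angular traces
entering the equations thereby become spacetime traces built from C⁻¹, ∂C and η, which make sense
off the cone as well. The linear equation can then be solved along every ray t ↦ t y of U. Because
its coefficients are homogeneous under rescaling of y, the solution read at t = 1 is a function of y
that restricts to φ/r on the cone. It is of class C^k because the coefficients depend on y in a C^k
way as elements of C([0,1]) (`bundle_substitution_contDiffOn`, `bundle_quotient_contDiffOn`) and the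
Volterra solution depends smoothly on its coefficients (`volterraSol_contDiff`).

For ν⁰ put c = (n-1)/2, G = exp ∫κ, ψ = φ/r. The integrating factor φ^c G turns the equation into
(ν⁰ φ^c G)' = r^(c-1) h, with h a C^k function. The boundary condition removes the homogeneous
solution, and the substitution ρ = s^(1/c) r in the integral of ρ^(c-1) h pulls out exactly the
factor r^c (`rpow_mul_weightedMean_hasDerivAt`). What remains is ν⁰ = H / (c G ψ^c) with H positive,
of class C^k, and equal to c at the vertex. -/

namespace LightCone

/-! ### Differentiability of maps into C(X, F) for compact X -/

section Families

variable {X E F E' F' : Type} [TopologicalSpace X] [CompactSpace X]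
  [NormedAddCommGroup E] [NormedSpace ℝ E] [NormedAddCommGroup F] [NormedSpace ℝ F]
  [NormedAddCommGroup E'] [NormedSpace ℝ E'] [NormedAddCommGroup F'] [NormedSpace ℝ F']

open Classical in
/-- The function `g` as an element of `C(X, F)`, or zero if `g` is not continuous. -/
noncomputable def bundle (g : X → F) : C(X, F) := if h : Continuous g then ⟨g, h⟩ else 0

theorem bundle_apply {g : X → F} (h : Continuous g) (x : X) : bundle g x = g x := by
  simp [bundle, h]

/-- `C(X, E →L F) →L (E →L C(X, F))`. -/
noncomputable def flipCM : C(X, E →L[ℝ] F) →L[ℝ] (E →L[ℝ] C(X, F)) :=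
  LinearMap.mkContinuous₂
    (LinearMap.mk₂ ℝ
      (fun (g : C(X, E →L[ℝ] F)) (v : E) => (⟨fun x => g x v, by fun_prop⟩ : C(X, F)))
      (fun _ _ _ => by ext; simp) (fun _ _ _ => by ext; simp)
      (fun _ _ _ => by ext; simp) (fun _ _ _ => by ext; simp)) 1
    (fun g v => by
      refine (ContinuousMap.norm_le _ (by positivity)).2 fun x => ?_
      simp only [LinearMap.mk₂_apply, ContinuousMap.coe_mk, one_mul]
      exact ((g x).le_opNorm v).trans (by gcongr; exact g.norm_coe_le_norm x))

theorem flipCM_apply (g : C(X, E →L[ℝ] F)) (v : E) (x : X) : flipCM g v x = g x v := rfl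

theorem slice_continuous {U : Set E} {f : X → E → F}
    (hf : ContinuousOn (fun p : X × E => f p.1 p.2) (univ ×ˢ U)) {y : E} (hy : y ∈ U) :
    Continuous fun x => f x y :=
  hf.comp_continuous (f := fun x : X => (x, y)) (by fun_prop) (fun x => ⟨mem_univ _, hy⟩)

theorem bundle_continuousOn {U : Set E} {f : X → E → F}
    (hf : ContinuousOn (fun p : X × E => f p.1 p.2) (univ ×ˢ U)) :
    ContinuousOn (fun y => bundle fun x => f x y) U := by
  have hc : Continuous fun p : U × X => f p.2 p.1 :=
    hf.comp_continuous (f := fun p : U × X => (p.2, (p.1 : E))) (by fun_prop)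
      (fun p => ⟨mem_univ _, p.1.2⟩)
  rw [continuousOn_iff_continuous_domRestrict]
  convert (ContinuousMap.curry ⟨_, hc⟩).continuous using 1
  ext y x
  simp only [Set.domRestrict_apply]
  rw [bundle_apply (slice_continuous hf y.2)]
  rfl

/-- Near y the derivatives f' x are within ε of f' x y uniformly in x, because y ↦ f' · y is
continuous into C(X, ·). The mean value inequality on a ball then bounds all remainders at once. -/
theorem bundle_hasFDerivAt {U : Set E} (hU : IsOpen U) {f : X → E → F} {f' : X → E → E →L[ℝ] F}
    (hf : ContinuousOn (fun p : X × E => f p.1 p.2) (univ ×ˢ U))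
    (hf' : ContinuousOn (fun p : X × E => f' p.1 p.2) (univ ×ˢ U))
    (hd : ∀ x, ∀ y ∈ U, HasFDerivAt (f x) (f' x y) y) {y : E} (hy : y ∈ U) :
    HasFDerivAt (fun y => bundle fun x => f x y) (flipCM (bundle fun x => f' x y)) y := by
  rw [hasFDerivAt_iff_isLittleO, Asymptotics.isLittleO_iff]
  intro ε hε
  have h1 : ∀ᶠ z in 𝓝 y, dist (bundle fun x => f' x z) (bundle fun x => f' x y) < ε :=
    Metric.tendsto_nhds.1 ((bundle_continuousOn hf').continuousAt (hU.mem_nhds hy)) ε hε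
  obtain ⟨δ, hδ, hball⟩ := Metric.eventually_nhds_iff_ball.1 (h1.and (hU.mem_nhds hy))
  filter_upwards [Metric.ball_mem_nhds y hδ] with z hz
  refine (ContinuousMap.norm_le _ (by positivity)).2 fun x => ?_
  have hzU := (hball z hz).2
  rw [ContinuousMap.sub_apply, ContinuousMap.sub_apply, flipCM_apply,
    bundle_apply (slice_continuous hf hzU), bundle_apply (slice_continuous hf hy),
    bundle_apply (slice_continuous hf' hy)]
  refine (convex_ball y δ).norm_image_sub_le_of_norm_hasFDerivWithin_le'
    (f' := f' x) (fun w hw => (hd x w (hball w hw).2).hasFDerivWithinAt) (fun w hw => ?_)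
    (Metric.mem_ball_self hδ) hz
  have h2 := (ContinuousMap.dist_apply_le_dist (f := bundle fun x => f' x w)
    (g := bundle fun x => f' x y) x).trans (hball w hw).1.le
  rwa [bundle_apply (slice_continuous hf' (hball w hw).2), bundle_apply (slice_continuous hf' hy),
    dist_eq_norm] at h2

theorem bundle_contDiffOn_succ {U : Set E} (hU : IsOpen U) {f : X → E → F}
    {f' : X → E → E →L[ℝ] F} {k : ℕ}
    (hf : ContinuousOn (fun p : X × E => f p.1 p.2) (univ ×ˢ U))
    (hf' : ContinuousOn (fun p : X × E => f' p.1 p.2) (univ ×ˢ U))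
    (hd : ∀ x, ∀ y ∈ U, HasFDerivAt (f x) (f' x y) y)
    (hk : ContDiffOn ℝ k (fun y => bundle fun x => f' x y) U) :
    ContDiffOn ℝ ((k + 1 : ℕ) : WithTop ℕ∞) (fun y => bundle fun x => f x y) U := by
  have h1 := fun y (hy : y ∈ U) => bundle_hasFDerivAt hU hf hf' hd hy
  push_cast
  rw [contDiffOn_succ_iff_fderiv_of_isOpen hU]
  refine ⟨fun y hy => (h1 y hy).differentiableAt.differentiableWithinAt, by simp, ?_⟩
  have h2 := (flipCM (X := X) (E := E) (F := F)).contDiff.comp_contDiffOn hk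
  exact h2.congr fun y hy => (h1 y hy).fderiv

theorem substitution_continuousOn {U : Set E} {W : Set E'} {h : E' → F'} (hh : ContinuousOn h W)
    {l : X → E →L[ℝ] E'} (hl : Continuous l) {A : X → F' →L[ℝ] F} (hA : Continuous A)
    (hmem : ∀ x, ∀ y ∈ U, l x y ∈ W) :
    ContinuousOn (fun p : X × E => A p.1 (h (l p.1 p.2))) (univ ×ˢ U) := by
  have h1 : ContinuousOn (fun p : X × E => h (l p.1 p.2)) (univ ×ˢ U) :=
    hh.comp (f := fun p : X × E => l p.1 p.2)
      (Continuous.continuousOn (by fun_prop)) (fun p hp => hmem p.1 p.2 hp.2)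
  exact (Continuous.continuousOn (f := fun p : X × E => A p.1) (by fun_prop)).clm_apply h1

/-- A `C^k` function composed with a continuous family of linear substitutions gives a `C^k` map
into the space of continuous functions of the parameter. -/
theorem bundle_substitution_contDiffOn {U : Set E} (hU : IsOpen U) {W : Set E'} (hW : IsOpen W)
    {l : X → E →L[ℝ] E'} (hl : Continuous l) (hmem : ∀ x, ∀ y ∈ U, l x y ∈ W) (k : ℕ) :
    ∀ {F F' : Type} [NormedAddCommGroup F] [NormedSpace ℝ F] [NormedAddCommGroup F']
      [NormedSpace ℝ F'] {h : E' → F'} {A : X → F' →L[ℝ] F}, Continuous A →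
      ContDiffOn ℝ k h W →
      ContDiffOn ℝ k (fun y => bundle fun x => A x (h (l x y))) U := by
  induction k with
  | zero =>
    intro F F' _ _ _ _ h A hA hh
    simp only [Nat.cast_zero, contDiffOn_zero] at hh ⊢
    exact bundle_continuousOn (substitution_continuousOn hh hl hA hmem)
  | succ k ih =>
    intro F F' _ _ _ _ h A hA hh
    have hh' := hh
    push_cast at hh'
    rw [contDiffOn_succ_iff_fderiv_of_isOpen hW] at hh'
    -- The derivative of A x (h (l x y)) in y is A x ∘ Dh (l x y) ∘ l x: again a continuous family
    -- of linear maps applied to a substituted function. This is why the target spaces and A vary in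
    -- the induction.
    let B : X → (E' →L[ℝ] F') →L[ℝ] (E →L[ℝ] F) := fun x =>
      (ContinuousLinearMap.compL ℝ E F' F (A x)).comp
        ((ContinuousLinearMap.compL ℝ E E' F').flip (l x))
    have hB : Continuous B := by
      have h1 : Continuous fun x => ContinuousLinearMap.compL ℝ E F' F (A x) := by fun_prop
      have h2 : Continuous fun x => (ContinuousLinearMap.compL ℝ E E' F').flip (l x) := by fun_prop
      exact h1.clm_comp h2
    refine bundle_contDiffOn_succ hU (f' := fun x y => B x (fderiv ℝ h (l x y)))
      (substitution_continuousOn hh.continuousOn hl hA hmem)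
      (substitution_continuousOn hh'.2.2.continuousOn hl hB hmem) (fun x y hy => ?_)
      (ih hB hh'.2.2)
    have h3 := (hh'.1.differentiableAt (hW.mem_nhds (hmem x y hy))).hasFDerivAt
    exact (A x).hasFDerivAt.comp y (h3.comp y (l x).hasFDerivAt)

end Families

/-! ### The family K(t y)/t, including t = 0 -/

section Quotient

variable {E : Type} [NormedAddCommGroup E] [NormedSpace ℝ E]

theorem StarConvex.scale_mem {U : Set E} (hs : StarConvex ℝ 0 U) {y : E} (hy : y ∈ U) {t : ℝ}
    (h0 : 0 ≤ t) (h1 : t ≤ 1) : t • y ∈ U := by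
  have := hs hy (sub_nonneg.2 h1) h0 (by ring)
  simpa using this

theorem quotient_continuousOn {U : Set E} (hU : IsOpen U) (hs : StarConvex ℝ 0 U)
    {K : E → ℝ} (hK : ContinuousOn K U) (hO : Asymptotics.IsBigO (𝓝 0) K (fun y => ‖y‖ ^ 2)) :
    ContinuousOn (fun p : unitInterval × E => K ((p.1 : ℝ) • p.2) / (p.1 : ℝ)) (univ ×ˢ U) := by
  rintro ⟨t, y⟩ ⟨-, hy⟩
  refine ContinuousAt.continuousWithinAt ?_
  have hmem : (t : ℝ) • y ∈ U := StarConvex.scale_mem hs hy t.2.1 t.2.2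
  have hsm : ContinuousAt (fun p : unitInterval × E => (p.1 : ℝ) • p.2) (t, y) := by fun_prop
  by_cases ht : (t : ℝ) = 0
  · obtain ⟨c, hc⟩ := hO.bound
    -- Division by zero gives the quotient the value 0 at t = 0. This is also its limit, since |K(t
    -- y)/t| ≤ c t |y|².
    have h0 : K (((t, y) : unitInterval × E).1.1 • ((t, y) : unitInterval × E).2) /
        ((t, y) : unitInterval × E).1.1 = 0 := by
      simp [ht]
    rw [ContinuousAt, h0]
    have h1 : Tendsto (fun p : unitInterval × E => (p.1 : ℝ) • p.2) (𝓝 (t, y)) (𝓝 0) := by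
      have := hsm.tendsto
      simpa [ht] using this
    have h2 : Tendsto (fun p : unitInterval × E => c * ((p.1 : ℝ) * ‖p.2‖ ^ 2)) (𝓝 (t, y))
        (𝓝 0) := by
      have : ContinuousAt (fun p : unitInterval × E => c * ((p.1 : ℝ) * ‖p.2‖ ^ 2)) (t, y) := by
        fun_prop
      simpa [ContinuousAt, ht] using this
    refine squeeze_zero_norm' ?_ h2
    filter_upwards [h1.eventually hc] with p hp
    have hp0 : 0 ≤ (p.1 : ℝ) := p.1.2.1
    rcases hp0.eq_or_lt with h | h
    · simp [← h]
    · rw [norm_div, Real.norm_of_nonneg hp0, div_le_iff₀ h]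
      refine hp.trans (le_of_eq ?_)
      rw [norm_pow, norm_norm, norm_smul, Real.norm_of_nonneg hp0]
      ring
  · refine ContinuousAt.div ?_ (by fun_prop) ht
    exact ContinuousAt.comp (f := fun p : unitInterval × E => (p.1 : ℝ) • p.2)
      (hK.continuousAt (hU.mem_nhds hmem)) hsm

/-- Dividing by t costs no derivative: the y-derivative of K(t y)/t is DK(t y), a plain substitution
into a function of one class less. Only continuity of the family itself at t = 0 needs the quadratic
bound when k = 0. -/
theorem bundle_quotient_contDiffOn {U : Set E} (hU : IsOpen U) (hs : StarConvex ℝ 0 U)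
    {K : E → ℝ} {k : ℕ} (hK : ContDiffOn ℝ k K U)
    (hO : Asymptotics.IsBigO (𝓝 0) K (fun y => ‖y‖ ^ 2)) :
    ContDiffOn ℝ k (fun y => bundle fun t : unitInterval => K ((t : ℝ) • y) / (t : ℝ)) U := by
  rcases k with _ | k
  · simp only [Nat.cast_zero, contDiffOn_zero] at hK ⊢
    exact bundle_continuousOn (quotient_continuousOn hU hs hK hO)
  have hK' := hK
  push_cast at hK'
  rw [contDiffOn_succ_iff_fderiv_of_isOpen hU] at hK'
  have hl : Continuous fun t : unitInterval => (t : ℝ) • ContinuousLinearMap.id ℝ E := by fun_prop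
  have hmem : ∀ t : unitInterval, ∀ y ∈ U, ((t : ℝ) • ContinuousLinearMap.id ℝ E) y ∈ U :=
    fun t y hy => StarConvex.scale_mem hs hy t.2.1 t.2.2
  have hA : Continuous fun _ : unitInterval => ContinuousLinearMap.id ℝ (E →L[ℝ] ℝ) := by fun_prop
  refine bundle_contDiffOn_succ hU (f' := fun (t : unitInterval) y => fderiv ℝ K ((t : ℝ) • y))
    (quotient_continuousOn hU hs hK.continuousOn hO)
    (substitution_continuousOn hK'.2.2.continuousOn hl hA hmem) (fun t y hy => ?_)
    (bundle_substitution_contDiffOn hU hU hl hmem k hA hK'.2.2)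
  by_cases ht : (t : ℝ) = 0
  -- At t = 0 the family is identically 0 by convention, so its derivative must agree with DK(0);
  -- the quadratic bound gives DK(0) = 0.
  · have h1 : HasFDerivAt K (0 : E →L[ℝ] ℝ) 0 := by
      have h2 : K 0 = 0 := by
        obtain ⟨c, hc⟩ := hO.bound
        simpa using hc.self_of_nhds
      rw [hasFDerivAt_iff_isLittleO]
      simp only [h2, sub_zero, zero_apply]
      refine hO.trans_isLittleO ?_
      have := Asymptotics.isLittleO_norm_pow_id (E' := E) (n := 2) (by norm_num)
      simpa using this
    simp only [ht, zero_smul, div_zero, h1.fderiv]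
    exact hasFDerivAt_const _ _
  · have h1 := (hK'.1.differentiableAt (hU.mem_nhds (hmem t y hy))).hasFDerivAt
    have h2 := (h1.comp y ((t : ℝ) • ContinuousLinearMap.id ℝ E).hasFDerivAt).mul_const
      ((t : ℝ)⁻¹)
    refine (h2.congr_fderiv ?_).congr_of_eventuallyEq (Eventually.of_forall fun z => ?_)
    · ext v
      simp [ht]
    · simp [div_eq_mul_inv]

end Quotient

/-! ### The integral equation for q' where q'' = a q' - b q -/

section Volterra

/-- The constant extension of a continuous function on the unit interval to the real line. -/
noncomputable def extend (w : C(unitInterval, ℝ)) : ℝ → ℝ := IccExtend zero_le_one w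

theorem extend_continuous (w : C(unitInterval, ℝ)) : Continuous (extend w) :=
  w.continuous.Icc_extend'

theorem extend_apply (w : C(unitInterval, ℝ)) {t : ℝ} (ht : t ∈ Icc (0 : ℝ) 1) :
    extend w t = w ⟨t, ht⟩ := IccExtend_of_mem _ _ ht

theorem abs_extend_le (w : C(unitInterval, ℝ)) (t : ℝ) : |extend w t| ≤ ‖w‖ :=
  w.norm_coe_le_norm _

theorem extend_add (v w : C(unitInterval, ℝ)) (t : ℝ) :
    extend (v + w) t = extend v t + extend w t := rfl

theorem extend_smul (c : ℝ) (w : C(unitInterval, ℝ)) (t : ℝ) :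
    extend (c • w) t = c * extend w t := rfl

theorem primitive_continuous (w : C(unitInterval, ℝ)) :
    Continuous fun t : ℝ => ∫ s in (0 : ℝ)..t, extend w s :=
  intervalIntegral.continuous_primitive
    (fun _ _ => (extend_continuous w).intervalIntegrable _ _) 0

/-- The primitive vanishing at zero, as an operator on `C([0, 1])`. -/
noncomputable def primitive : C(unitInterval, ℝ) →L[ℝ] C(unitInterval, ℝ) :=
  LinearMap.mkContinuous
    { toFun := fun w => ⟨fun t => ∫ s in (0 : ℝ)..t, extend w s,
        (primitive_continuous w).comp continuous_subtype_val⟩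
      map_add' := fun v w => by
        ext t
        simp only [ContinuousMap.coe_mk, ContinuousMap.add_apply, extend_add]
        exact intervalIntegral.integral_add ((extend_continuous v).intervalIntegrable _ _)
          ((extend_continuous w).intervalIntegrable _ _)
      map_smul' := fun c w => by
        ext t
        simp [extend_smul] } 1
    (fun w => by
      refine (ContinuousMap.norm_le _ (by positivity)).2 fun t => ?_
      have h := intervalIntegral.norm_integral_le_of_norm_le_const (a := 0) (b := (t : ℝ))
        (f := extend w) (C := ‖w‖) (fun s _ => abs_extend_le w s)
      refine h.trans ?_
      rw [sub_zero, abs_of_nonneg t.2.1, one_mul]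
      exact mul_le_of_le_one_right (norm_nonneg _) t.2.2)

theorem primitive_apply (w : C(unitInterval, ℝ)) (t : unitInterval) :
    primitive w t = ∫ s in (0 : ℝ)..t, extend w s := rfl

/-- The Volterra operator `w ↦ ∫ (a w - b ∫ w)`. -/
noncomputable def volterra (a b : C(unitInterval, ℝ)) :
    C(unitInterval, ℝ) →L[ℝ] C(unitInterval, ℝ) :=
  primitive.comp (ContinuousLinearMap.mul ℝ _ a -
    (ContinuousLinearMap.mul ℝ _ b).comp primitive)

theorem volterra_apply (a b w : C(unitInterval, ℝ)) :
    volterra a b w = primitive (a * w - b * primitive w) := rfl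

theorem abs_primitive_le {w : C(unitInterval, ℝ)} {B : ℝ} {j : ℕ}
    (hw : ∀ t : unitInterval, |w t| ≤ B * (t : ℝ) ^ j / j.factorial) (t : unitInterval) :
    |primitive w t| ≤ B * (t : ℝ) ^ (j + 1) / (j + 1).factorial := by
  rw [primitive_apply]
  have hb : ∀ s ∈ Ioc (0 : ℝ) t, ‖extend w s‖ ≤ B * s ^ j / j.factorial := fun s hs => by
    have hs1 : s ∈ Icc (0 : ℝ) 1 := ⟨hs.1.le, hs.2.trans t.2.2⟩
    rw [extend_apply w hs1]
    exact hw ⟨s, hs1⟩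
  have h := intervalIntegral.norm_integral_le_of_norm_le (μ := MeasureTheory.volume) t.2.1
    (Filter.Eventually.of_forall hb)
    (Continuous.intervalIntegrable (u := fun s : ℝ => B * s ^ j / j.factorial) (by fun_prop) _ _)
  refine h.trans (le_of_eq ?_)
  rw [intervalIntegral.integral_div, intervalIntegral.integral_const_mul, integral_pow,
    Nat.factorial_succ]
  push_cast
  field_simp
  ring

/-- Each iteration integrates once more, which produces t^j/j!. The inner primitive gains a further
power of t, and this is discarded since t ≤ 1. -/
theorem abs_volterra_pow_le (a b w : C(unitInterval, ℝ)) (j : ℕ) (t : unitInterval) :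
    |(volterra a b ^ j) w t| ≤ (‖a‖ + ‖b‖) ^ j * ‖w‖ * (t : ℝ) ^ j / j.factorial := by
  induction j generalizing t with
  | zero => simpa using w.norm_coe_le_norm t
  | succ j ih =>
    rw [pow_succ' (volterra a b), mul_apply_eq_comp, volterra_apply]
    set v := (volterra a b ^ j) w
    rw [show (‖a‖ + ‖b‖) ^ (j + 1) * ‖w‖ = (‖a‖ + ‖b‖) * ((‖a‖ + ‖b‖) ^ j * ‖w‖) by ring]
    refine abs_primitive_le (fun s => ?_) t
    set B := (‖a‖ + ‖b‖) ^ j * ‖w‖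
    have hB : 0 ≤ B := by positivity
    have hs0 : 0 ≤ (s : ℝ) := s.2.1
    have h1 := ih s
    have h2 := abs_primitive_le ih s
    have h3 : B * (s : ℝ) ^ (j + 1) / (j + 1).factorial ≤ B * (s : ℝ) ^ j / j.factorial := by
      have h4 : (s : ℝ) ^ (j + 1) ≤ (s : ℝ) ^ j := pow_le_pow_of_le_one hs0 s.2.2 (by omega)
      have h5 : (j.factorial : ℝ) ≤ (j + 1).factorial := by
        exact_mod_cast Nat.factorial_le (by omega)
      gcongr
    rw [ContinuousMap.sub_apply, ContinuousMap.mul_apply, ContinuousMap.mul_apply]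
    calc |a s * v s - b s * primitive v s| ≤ |a s * v s| + |b s * primitive v s| := abs_sub _ _
      _ = |a s| * |v s| + |b s| * |primitive v s| := by rw [abs_mul, abs_mul]
      _ ≤ ‖a‖ * (B * (s : ℝ) ^ j / j.factorial) + ‖b‖ * (B * (s : ℝ) ^ j / j.factorial) := by
        gcongr
        · exact a.norm_coe_le_norm s
        · exact b.norm_coe_le_norm s
        · exact h2.trans h3
      _ = (‖a‖ + ‖b‖) * B * (s : ℝ) ^ j / j.factorial := by ring

/-- Some power V^N has norm below 1, so 1 - V^N is invertible, and 1 - V is a factor of it that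
commutes with the cofactor. No smallness of a and b is needed, so the solution exists over all of U.
-/
theorem isUnit_one_sub_volterra (a b : C(unitInterval, ℝ)) : IsUnit (1 - volterra a b) := by
  obtain ⟨N, hN⟩ : ∃ N : ℕ, (‖a‖ + ‖b‖) ^ N / N.factorial < 1 :=
    ((FloorSemiring.tendsto_pow_div_factorial_atTop (‖a‖ + ‖b‖)).eventually_lt_const
      one_pos).exists
  have h1 : ‖volterra a b ^ N‖ < 1 := by
    refine lt_of_le_of_lt (ContinuousLinearMap.opNorm_le_bound _ (by positivity) fun w => ?_) hN
    refine (ContinuousMap.norm_le _ (by positivity)).2 fun t => ?_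
    refine (abs_volterra_pow_le a b w N t).trans ?_
    have ht : (t : ℝ) ^ N ≤ 1 := pow_le_one₀ t.2.1 t.2.2
    calc (‖a‖ + ‖b‖) ^ N * ‖w‖ * (t : ℝ) ^ N / N.factorial
        ≤ (‖a‖ + ‖b‖) ^ N * ‖w‖ * 1 / N.factorial := by gcongr
      _ = _ := by ring
  have h2 : IsUnit (1 - volterra a b ^ N) := (Units.oneSub (volterra a b ^ N) h1).isUnit
  rw [← mul_neg_geom_sum] at h2
  exact ((Commute.isUnit_mul_iff
    ((mul_neg_geom_sum _ _).trans (geom_sum_mul_neg _ _).symm)).1 h2).1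

/-- The solution of `w = 1 + ∫ (a w - b ∫ w)`. -/
noncomputable def volterraSol (a b : C(unitInterval, ℝ)) : C(unitInterval, ℝ) :=
  Ring.inverse (1 - volterra a b) 1

theorem volterraSol_eq (a b : C(unitInterval, ℝ)) :
    volterraSol a b = 1 + volterra a b (volterraSol a b) := by
  have h := congrArg (fun T : C(unitInterval, ℝ) →L[ℝ] C(unitInterval, ℝ) => T 1)
    (Ring.mul_inverse_cancel _ (isUnit_one_sub_volterra a b))
  simp only [mul_apply_eq_comp] at h
  exact sub_eq_iff_eq_add.1 h

theorem eq_volterraSol {a b w : C(unitInterval, ℝ)} (h : w = 1 + volterra a b w) :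
    w = volterraSol a b := by
  have h1 : (1 - volterra a b) w = 1 := sub_eq_iff_eq_add.2 h
  have h2 := congrArg (fun T : C(unitInterval, ℝ) →L[ℝ] C(unitInterval, ℝ) => T w)
    (Ring.inverse_mul_cancel _ (isUnit_one_sub_volterra a b))
  simp only [mul_apply_eq_comp, h1] at h2
  exact h2.symm

theorem volterra_contDiff {n : WithTop ℕ∞} :
    ContDiff ℝ n fun p : C(unitInterval, ℝ) × C(unitInterval, ℝ) => volterra p.1 p.2 := by
  have h2 : ContDiff ℝ n fun p : C(unitInterval, ℝ) × C(unitInterval, ℝ) =>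
    ContinuousLinearMap.mul ℝ C(unitInterval, ℝ) p.1 := by fun_prop
  have h3 : ContDiff ℝ n fun p : C(unitInterval, ℝ) × C(unitInterval, ℝ) =>
    ContinuousLinearMap.mul ℝ C(unitInterval, ℝ) p.2 := by fun_prop
  exact contDiff_const.clm_comp (h2.sub (h3.clm_comp contDiff_const))

/-- The operator is linear in each coefficient up to composition with fixed operators, and inversion
in a Banach algebra is smooth at units. This replaces a theorem on parameter dependence of ODEs. -/
theorem volterraSol_contDiff {n : WithTop ℕ∞} :
    ContDiff ℝ n fun p : C(unitInterval, ℝ) × C(unitInterval, ℝ) => volterraSol p.1 p.2 := by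
  have h1 : ContDiff ℝ n fun p : C(unitInterval, ℝ) × C(unitInterval, ℝ) =>
      1 - volterra p.1 p.2 := contDiff_const.sub volterra_contDiff
  rw [contDiff_iff_contDiffAt]
  intro p
  have h3 : ContDiffAt ℝ n Ring.inverse (1 - volterra p.1 p.2) := by
    obtain ⟨u, hu⟩ := isUnit_one_sub_volterra p.1 p.2
    rw [← hu]
    exact contDiffAt_ringInverse (R := C(unitInterval, ℝ) →L[ℝ] C(unitInterval, ℝ)) ℝ u
  have h2 := ContDiffAt.comp p h3 h1.contDiffAt
  have h4 : ContDiffAt ℝ n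
      (fun p : C(unitInterval, ℝ) × C(unitInterval, ℝ) => Ring.inverse (1 - volterra p.1 p.2)) p :=
    h2
  unfold volterraSol
  exact h4.clm_apply contDiffAt_const

end Volterra

/-! ### Behaviour of the solution under rescaling of the interval -/

section Scaling

/-- Evaluation at `1`. -/
def evalOne : C(unitInterval, ℝ) →L[ℝ] ℝ := ContinuousMap.evalCLM ℝ (1 : unitInterval)

/-- Rescaling of the argument. -/
def rescale (s : unitInterval) (w : C(unitInterval, ℝ)) : C(unitInterval, ℝ) :=
  ⟨fun t => w (s * t), by fun_prop⟩

theorem rescale_apply (s : unitInterval) (w : C(unitInterval, ℝ)) (t : unitInterval) :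
    rescale s w t = w (s * t) := rfl

theorem primitive_hasDerivAt (w : C(unitInterval, ℝ)) (t : ℝ) :
    HasDerivAt (fun t => ∫ s in (0 : ℝ)..t, extend w s) (extend w t) t :=
  intervalIntegral.integral_hasDerivAt_right
    ((extend_continuous w).intervalIntegrable _ _)
    (extend_continuous w).stronglyMeasurable.stronglyMeasurableAtFilter
    (extend_continuous w).continuousAt

theorem primitive_rescale (s : unitInterval) (w : C(unitInterval, ℝ)) :
    (s : ℝ) • primitive (rescale s w) = rescale s (primitive w) := by
  ext t
  simp only [ContinuousMap.smul_apply, rescale_apply, primitive_apply, smul_eq_mul]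
  have h := intervalIntegral.mul_integral_comp_mul_left (a := 0) (b := (t : ℝ)) (f := extend w)
    (s : ℝ)
  rw [mul_zero] at h
  rw [show ((s * t : unitInterval) : ℝ) = (s : ℝ) * t from rfl, ← h]
  congr 1
  refine intervalIntegral.integral_congr fun σ hσ => ?_
  rw [uIcc_of_le t.2.1] at hσ
  have h1 : σ ∈ Icc (0 : ℝ) 1 := ⟨hσ.1, hσ.2.trans t.2.2⟩
  have h2 : (s : ℝ) * σ ∈ Icc (0 : ℝ) 1 := (s * ⟨σ, h1⟩ : unitInterval).2
  rw [extend_apply _ h1, extend_apply _ h2]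
  rfl

/-- If w solves the equation, then t ↦ w(s t) has derivative s (a w - b q)(s t), while its own
primitive is q(s t)/s. This accounts for the weights s and s², matching coefficients homogeneous of
degree 1 and 2. -/
theorem volterraSol_rescale (s : unitInterval) (a b : C(unitInterval, ℝ)) :
    volterraSol ((s : ℝ) • rescale s a) ((s : ℝ) ^ 2 • rescale s b) =
      rescale s (volterraSol a b) := by
  symm
  apply eq_volterraSol
  set w := volterraSol a b with hw
  have h1 : rescale s w = 1 + rescale s (volterra a b w) := by
    conv_lhs => rw [hw, volterraSol_eq, ← hw]
    rfl
  have h2 : ((s : ℝ) • rescale s a) * rescale s w -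
      ((s : ℝ) ^ 2 • rescale s b) * primitive (rescale s w) =
      (s : ℝ) • rescale s (a * w - b * primitive w) := by
    have h3 := primitive_rescale s w
    have h4 : rescale s (a * w - b * primitive w) =
      rescale s a * rescale s w - rescale s b * rescale s (primitive w) := rfl
    rw [h4, ← h3]
    ext t
    simp
    ring
  rw [volterra_apply, h2, map_smul, primitive_rescale]
  exact h1

end Scaling

/-! ### Homogeneous coefficients along rays, and functions of the end point -/

section Radial

variable {E : Type} [NormedAddCommGroup E] [NormedSpace ℝ E]

/-- A family of coefficients along the rays `t ↦ t • y`, homogeneous of degree `p`. -/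
structure RadialFamily (U : Set E) (k : ℕ∞) (p : ℕ) (f : ℝ → E → ℝ) : Prop where
  cont : ∀ y ∈ U, Continuous fun t : unitInterval => f t y
  smooth : ContDiffOn ℝ k (fun y => bundle fun t : unitInterval => f t y) U
  homog : ∀ t r y, 0 ≤ r → f t (r • y) = r ^ p * f (r * t) y

/-- The slice of a family at `y`. -/
noncomputable abbrev slice (f : ℝ → E → ℝ) (y : E) : C(unitInterval, ℝ) :=
  bundle fun t : unitInterval => f t y

variable {U : Set E} {k : ℕ∞} {p : ℕ} {f a b : ℝ → E → ℝ}

theorem RadialFamily.slice_apply (hf : RadialFamily U k p f) {y : E} (hy : y ∈ U)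
    (t : unitInterval) : slice f y t = f t y := bundle_apply (hf.cont y hy) t

theorem RadialFamily.slice_smul (hf : RadialFamily U k p f) (hs : StarConvex ℝ 0 U) {y : E}
    (hy : y ∈ U) (s : unitInterval) :
    slice f ((s : ℝ) • y) = (s : ℝ) ^ p • rescale s (slice f y) := by
  ext t
  rw [hf.slice_apply (StarConvex.scale_mem hs hy s.2.1 s.2.2)]
  simp only [ContinuousMap.smul_apply, rescale_apply, smul_eq_mul]
  rw [hf.slice_apply hy, hf.homog _ _ _ s.2.1]
  rfl

theorem RadialFamily.slice_zero (hf : RadialFamily U k p f) (hp : p ≠ 0) (h0 : (0 : E) ∈ U) :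
    slice f 0 = 0 := by
  ext t
  rw [hf.slice_apply h0]
  simpa [hp] using hf.homog t 0 0 le_rfl

theorem RadialFamily.extend_slice (hf : RadialFamily U k p f) {g : E} {r R : ℝ} (hr : 0 ≤ r)
    (hrR : r ≤ R) (hR : 0 < R) (hg : R • g ∈ U) :
    extend (slice f (R • g)) (r / R) = R ^ p * f r g := by
  have h1 : r / R ∈ Icc (0 : ℝ) 1 := ⟨by positivity, (div_le_one hR).2 hrR⟩
  rw [extend_apply _ h1, hf.slice_apply hg, hf.homog _ _ _ hR.le]
  congr 2
  field_simp

/-- Derivatives at r are two-sided. A reference point R g beyond r lets one fixed slice,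
reparametrized by r/R, describe a whole neighbourhood of r. -/
theorem exists_smul_mem_of_isOpen (hU : IsOpen U) {g : E} {r : ℝ} (hg : r • g ∈ U) :
    ∃ R, r < R ∧ R • g ∈ U := by
  have h1 : ∀ᶠ R in 𝓝 r, R • g ∈ U :=
    (Continuous.tendsto (by fun_prop : Continuous fun R : ℝ => R • g) r).eventually
      (hU.mem_nhds hg)
  have h2 : ∀ᶠ R in 𝓝[>] r, R • g ∈ U := h1.filter_mono nhdsWithin_le_nhds
  obtain ⟨R, h3, h4⟩ := (h2.and self_mem_nhdsWithin).exists
  exact ⟨R, h4, h3⟩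

theorem smul_eq_rescaled {g : E} {r R : ℝ} (hR : 0 < R) : r • g = (r / R) • R • g := by
  rw [smul_smul]
  congr 1
  field_simp

/-- `∫₀¹ f t y dt`. -/
noncomputable def radialInt (f : ℝ → E → ℝ) (y : E) : ℝ := primitive (slice f y) 1

theorem RadialFamily.radialInt_contDiffOn (hf : RadialFamily U k p f) :
    ContDiffOn ℝ k (radialInt f) U := by
  have h1 := evalOne.contDiff (n := k)
  exact h1.comp_contDiffOn (primitive.contDiff.comp_contDiffOn hf.smooth)

theorem RadialFamily.radialInt_zero (hf : RadialFamily U k p f) (hp : p ≠ 0) (h0 : (0 : E) ∈ U) :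
    radialInt f 0 = 0 := by
  simp [radialInt, hf.slice_zero hp h0]

theorem RadialFamily.radialInt_hasDerivAt (hf : RadialFamily U k 1 f) (hU : IsOpen U)
    (hs : StarConvex ℝ 0 U) {g : E} {r : ℝ} (hr : 0 < r) (hg : r • g ∈ U) :
    HasDerivAt (fun r : ℝ => radialInt f (r • g)) (f r g) r := by
  obtain ⟨R, hrR, hR⟩ := exists_smul_mem_of_isOpen hU hg
  have hR0 : 0 < R := hr.trans hrR
  have h1 : HasDerivAt (fun r => ∫ s in (0 : ℝ)..(r / R), extend (slice f (R • g)) s)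
      (extend (slice f (R • g)) (r / R) * (1 / R)) r :=
    (primitive_hasDerivAt _ _).comp r ((hasDerivAt_id r).div_const R)
  rw [hf.extend_slice hr.le hrR.le hR0 hR] at h1
  refine (h1.congr_deriv (by field_simp)).congr_of_eventuallyEq ?_
  filter_upwards [Ioo_mem_nhds hr hrR] with x hx
  have h2 : x / R ∈ Icc (0 : ℝ) 1 := ⟨(div_pos hx.1 hR0).le, (div_le_one hR0).2 hx.2.le⟩
  have h3 := hf.slice_smul hs hR ⟨x / R, h2⟩
  have h4 := congrArg (fun w : C(unitInterval, ℝ) => w 1)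
    (primitive_rescale ⟨x / R, h2⟩ (slice f (R • g)))
  simp only [pow_one] at h3
  simp only [ContinuousMap.smul_apply, rescale_apply, mul_one, primitive_apply] at h4
  rw [radialInt, smul_eq_rescaled (r := x) hR0, h3, map_smul, ContinuousMap.smul_apply,
    primitive_apply, h4]

/-- The value at `t = 1` of the solution of `q'' = a q' - b q`, `q 0 = 0`, `q' 0 = 1`. -/
noncomputable def jacobi (a b : ℝ → E → ℝ) (y : E) : ℝ :=
  primitive (volterraSol (slice a y) (slice b y)) 1

/-- The value of `q'` at `t = 1`. -/
noncomputable def jacobiDeriv (a b : ℝ → E → ℝ) (y : E) : ℝ :=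
  volterraSol (slice a y) (slice b y) 1

theorem jacobi_contDiffOn (ha : RadialFamily U k 1 a) (hb : RadialFamily U k 2 b) :
    ContDiffOn ℝ k (jacobi a b) U := by
  have h1 := evalOne.contDiff (n := k)
  exact h1.comp_contDiffOn (primitive.contDiff.comp_contDiffOn
    (volterraSol_contDiff.comp_contDiffOn (ha.smooth.prodMk hb.smooth)))

theorem jacobi_zero (ha : RadialFamily U k 1 a) (hb : RadialFamily U k 2 b) (h0 : (0 : E) ∈ U) :
    jacobi a b 0 = 1 := by
  have h1 : volterraSol 0 0 = 1 := by
    rw [volterraSol_eq, volterra_apply]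
    simp
  rw [jacobi, ha.slice_zero (by norm_num) h0, hb.slice_zero (by norm_num) h0, h1, primitive_apply]
  have h2 : ∀ s, extend 1 s = 1 := fun s => rfl
  simp [h2]

theorem volterraSol_slice_smul (ha : RadialFamily U k 1 a) (hb : RadialFamily U k 2 b)
    (hs : StarConvex ℝ 0 U) {y : E} (hy : y ∈ U) (s : unitInterval) :
    volterraSol (slice a ((s : ℝ) • y)) (slice b ((s : ℝ) • y)) =
      rescale s (volterraSol (slice a y) (slice b y)) := by
  rw [ha.slice_smul hs hy, hb.slice_smul hs hy, pow_one, volterraSol_rescale]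

/-- By homogeneity all points of a ray share one solution up to scaling: the value at t = 1 for the
end point r g, multiplied by r, is the solution along g at parameter r. -/
theorem mul_jacobi_eq (ha : RadialFamily U k 1 a) (hb : RadialFamily U k 2 b)
    (hs : StarConvex ℝ 0 U) {g : E} {r R : ℝ} (hr : 0 ≤ r) (hrR : r ≤ R) (hR : 0 < R)
    (hg : R • g ∈ U) :
    r * jacobi a b (r • g) = R * ∫ s in (0 : ℝ)..(r / R),
      extend (volterraSol (slice a (R • g)) (slice b (R • g))) s := by
  have h2 : r / R ∈ Icc (0 : ℝ) 1 := ⟨by positivity, (div_le_one hR).2 hrR⟩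
  have h3 := volterraSol_slice_smul ha hb hs hg ⟨r / R, h2⟩
  have h4 := congrArg (fun w : C(unitInterval, ℝ) => w 1)
    (primitive_rescale ⟨r / R, h2⟩ (volterraSol (slice a (R • g)) (slice b (R • g))))
  simp only at h3
  simp only [ContinuousMap.smul_apply, rescale_apply, mul_one, primitive_apply] at h4
  rw [jacobi, smul_eq_rescaled (r := r) hR, h3, ← h4, smul_eq_mul, primitive_apply]
  field_simp

theorem jacobiDeriv_eq (ha : RadialFamily U k 1 a) (hb : RadialFamily U k 2 b)
    (hs : StarConvex ℝ 0 U) {g : E} {r R : ℝ} (hr : 0 ≤ r) (hrR : r ≤ R) (hR : 0 < R)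
    (hg : R • g ∈ U) :
    jacobiDeriv a b (r • g) =
      extend (volterraSol (slice a (R • g)) (slice b (R • g))) (r / R) := by
  have h2 : r / R ∈ Icc (0 : ℝ) 1 := ⟨by positivity, (div_le_one hR).2 hrR⟩
  have h3 := volterraSol_slice_smul ha hb hs hg ⟨r / R, h2⟩
  simp only at h3
  rw [jacobiDeriv, smul_eq_rescaled (r := r) hR, h3, rescale_apply, mul_one, extend_apply _ h2]

theorem mul_jacobi_hasDerivAt (ha : RadialFamily U k 1 a) (hb : RadialFamily U k 2 b)
    (hU : IsOpen U) (hs : StarConvex ℝ 0 U) {g : E} {r : ℝ} (hr : 0 < r) (hg : r • g ∈ U) :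
    HasDerivAt (fun r : ℝ => r * jacobi a b (r • g)) (jacobiDeriv a b (r • g)) r := by
  obtain ⟨R, hrR, hR⟩ := exists_smul_mem_of_isOpen hU hg
  have hR0 : 0 < R := hr.trans hrR
  have h1 := ((primitive_hasDerivAt (volterraSol (slice a (R • g)) (slice b (R • g))) _).comp r
    ((hasDerivAt_id r).div_const R)).const_mul R
  rw [id, ← jacobiDeriv_eq ha hb hs hr.le hrR.le hR0 hR] at h1
  refine (h1.congr_deriv (by field_simp)).congr_of_eventuallyEq ?_
  filter_upwards [Ioo_mem_nhds hr hrR] with x hx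
  exact mul_jacobi_eq ha hb hs hx.1.le hx.2.le hR0 hR

theorem jacobiDeriv_hasDerivAt (ha : RadialFamily U k 1 a) (hb : RadialFamily U k 2 b)
    (hU : IsOpen U) (hs : StarConvex ℝ 0 U) {g : E} {r : ℝ} (hr : 0 < r) (hg : r • g ∈ U) :
    HasDerivAt (fun r : ℝ => jacobiDeriv a b (r • g))
      (a r g * jacobiDeriv a b (r • g) - b r g * (r * jacobi a b (r • g))) r := by
  obtain ⟨R, hrR, hR⟩ := exists_smul_mem_of_isOpen hU hg
  have hR0 : 0 < R := hr.trans hrR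
  set w := volterraSol (slice a (R • g)) (slice b (R • g)) with hw
  set z := slice a (R • g) * w - slice b (R • g) * primitive w with hz
  have h1 := ((primitive_hasDerivAt z _).comp r ((hasDerivAt_id r).div_const R)).const_add 1
  have hmem : ∀ x ∈ Ioo 0 R, x / R ∈ Icc (0 : ℝ) 1 := fun x hx =>
    ⟨(div_pos hx.1 hR0).le, (div_le_one hR0).2 hx.2.le⟩
  have h2 : extend z (r / R) = R * (a r g * jacobiDeriv a b (r • g) -
      b r g * (r * jacobi a b (r • g))) := by
    have h3 : extend z (r / R) = extend (slice a (R • g)) (r / R) * extend w (r / R) -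
      extend (slice b (R • g)) (r / R) * extend (primitive w) (r / R) := rfl
    rw [h3, ha.extend_slice hr.le hrR.le hR0 hR, hb.extend_slice hr.le hrR.le hR0 hR,
      ← jacobiDeriv_eq ha hb hs hr.le hrR.le hR0 hR, mul_jacobi_eq ha hb hs hr.le hrR.le hR0 hR,
      extend_apply _ (hmem r ⟨hr, hrR⟩), primitive_apply]
    ring
  rw [id, h2] at h1
  refine (h1.congr_deriv (by field_simp)).congr_of_eventuallyEq ?_
  filter_upwards [Ioo_mem_nhds hr hrR] with x hx
  rw [jacobiDeriv_eq ha hb hs hx.1.le hx.2.le hR0 hR, ← hw, extend_apply _ (hmem x hx), hw,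
    volterraSol_eq, ← hw, volterra_apply, ← hz]
  rfl

/-- `∫₀¹ h (s^{1/c} y) ds`. -/
noncomputable def weightedMean (c : ℝ) (h : E → ℝ) (y : E) : ℝ :=
  primitive (bundle fun s : unitInterval => h ((s : ℝ) ^ (1 / c) • y)) 1

variable {c : ℝ} {h : E → ℝ}

theorem rpow_mem_Icc (hc : 0 < c) {s : ℝ} (hs : s ∈ Icc (0 : ℝ) 1) :
    s ^ (1 / c) ∈ Icc (0 : ℝ) 1 :=
  ⟨Real.rpow_nonneg hs.1 _, Real.rpow_le_one hs.1 hs.2 (by positivity)⟩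

/-- Regularity in y requires the substitution to be merely continuous in s, so the lack of
smoothness of s^(1/c) at 0 is harmless. -/
theorem rpow_substitution_continuous (hc : 0 < c) :
    Continuous fun s : unitInterval => ((s : ℝ) ^ (1 / c)) • ContinuousLinearMap.id ℝ E :=
  (continuous_subtype_val.rpow_const fun _ => Or.inr (by positivity)).smul continuous_const

theorem weightedMean_contDiffOn (hc : 0 < c) (hU : IsOpen U) (hs : StarConvex ℝ 0 U)
    (hh : ContDiffOn ℝ k h U) : ContDiffOn ℝ k (weightedMean c h) U := by
  have h1 := evalOne.contDiff (n := k)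
  refine h1.comp_contDiffOn (primitive.contDiff.comp_contDiffOn ?_)
  rw [contDiffOn_iff_forall_nat_le] at hh ⊢
  intro j hj
  exact bundle_substitution_contDiffOn hU hU (rpow_substitution_continuous hc)
    (fun t y hy => StarConvex.scale_mem hs hy (rpow_mem_Icc hc t.2).1 (rpow_mem_Icc hc t.2).2) j
    (A := fun _ => ContinuousLinearMap.id ℝ ℝ) continuous_const (hh j hj)

theorem weighted_slice_continuous (hc : 0 < c) (hs : StarConvex ℝ 0 U)
    (hh : ContinuousOn h U) {y : E} (hy : y ∈ U) :
    Continuous fun s : unitInterval => h ((s : ℝ) ^ (1 / c) • y) :=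
  hh.comp_continuous (((rpow_substitution_continuous (E := E) hc).clm_apply
    (continuous_const (y := y)))) fun t =>
      StarConvex.scale_mem hs hy (rpow_mem_Icc hc t.2).1 (rpow_mem_Icc hc t.2).2

theorem weightedMean_zero : weightedMean c h 0 = h 0 := by
  have h1 : (bundle fun s : unitInterval => h ((s : ℝ) ^ (1 / c) • (0 : E))) =
      ContinuousMap.const _ (h 0) := by
    ext s
    rw [bundle_apply] <;> simp [continuous_const]
  rw [weightedMean, h1, primitive_apply]
  have h2 : ∀ s, extend (ContinuousMap.const _ (h 0)) s = h 0 := fun s => rfl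
  simp [h2]

theorem weightedMean_pos (hc : 0 < c) (hs : StarConvex ℝ 0 U)
    (hh : ContinuousOn h U) (hpos : ∀ y ∈ U, 0 < h y) {y : E} (hy : y ∈ U) :
    0 < weightedMean c h y := by
  rw [weightedMean, primitive_apply]
  refine intervalIntegral.intervalIntegral_pos_of_pos
    ((extend_continuous _).intervalIntegrable _ _) (fun s => ?_) (by simp)
  simp only [extend, IccExtend, Function.comp]
  rw [bundle_apply (weighted_slice_continuous hc hs hh hy)]
  have h1 := (rpow_mem_Icc hc (projIcc (0 : ℝ) 1 zero_le_one s).2)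
  exact hpos _ (StarConvex.scale_mem hs hy h1.1 h1.2)

/-- With ρ = s^(1/c) r the mean becomes c r^(-c) ∫₀^r ρ^(c-1) h(ρ g) dρ. The possibly fractional
power of r is thus split off, leaving a factor that is regular at the vertex. -/
theorem rpow_mul_weightedMean_hasDerivAt (hc : 0 < c) (hU : IsOpen U) (hs : StarConvex ℝ 0 U)
    (hh : ContinuousOn h U) {g : E} {r : ℝ} (hr : 0 < r) (hg : r • g ∈ U) :
    HasDerivAt (fun r : ℝ => r ^ c * weightedMean c h (r • g))
      (c * r ^ (c - 1) * h (r • g)) r := by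
  obtain ⟨R, hrR, hR⟩ := exists_smul_mem_of_isOpen hU hg
  have hR0 : 0 < R := hr.trans hrR
  set w := bundle fun s : unitInterval => h ((s : ℝ) ^ (1 / c) • R • g) with hw
  have hmem : ∀ x ∈ Ioo 0 R, (x / R) ^ c ∈ Icc (0 : ℝ) 1 := fun x hx =>
    ⟨Real.rpow_nonneg (div_pos hx.1 hR0).le _,
      Real.rpow_le_one (div_pos hx.1 hR0).le ((div_le_one hR0).2 hx.2.le) hc.le⟩
  have hrc : ∀ x : ℝ, 0 ≤ x → (x ^ c) ^ (1 / c) = x := fun x hx => by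
    rw [← Real.rpow_mul hx, mul_one_div_cancel hc.ne', Real.rpow_one]
  have h0 : HasDerivAt (fun x : ℝ => (x / R) ^ c) (1 / R * c * (r / R) ^ (c - 1)) r :=
    ((hasDerivAt_id r).div_const R).rpow_const (Or.inl (div_pos hr hR0).ne')
  have h1 := ((primitive_hasDerivAt w _).comp r h0).const_mul (R ^ c)
  have h2 : extend w ((r / R) ^ c) = h (r • g) := by
    rw [extend_apply _ (hmem r ⟨hr, hrR⟩), hw,
      bundle_apply (weighted_slice_continuous hc hs hh hR), hrc _ (div_pos hr hR0).le,
      ← smul_eq_rescaled hR0]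
  rw [h2] at h1
  refine (h1.congr_deriv ?_).congr_of_eventuallyEq ?_
  · rw [Real.div_rpow hr.le hR0.le, Real.rpow_sub_one hR0.ne']
    have := (Real.rpow_pos_of_pos hR0 c).ne'
    field_simp
  filter_upwards [Ioo_mem_nhds hr hrR] with x hx
  have hx0 : 0 ≤ x / R := (div_pos hx.1 hR0).le
  have h3 : (bundle fun s : unitInterval => h ((s : ℝ) ^ (1 / c) • x • g)) =
      rescale ⟨_, hmem x hx⟩ w := by
    have hxU : x • g ∈ U := by
      rw [smul_eq_rescaled (r := x) hR0]
      exact StarConvex.scale_mem hs hR hx0 ((div_le_one hR0).2 hx.2.le)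
    ext s
    rw [bundle_apply (weighted_slice_continuous hc hs hh hxU), rescale_apply, hw,
      bundle_apply (weighted_slice_continuous hc hs hh hR)]
    have h4 : (((⟨_, hmem x hx⟩ : unitInterval) * s : unitInterval) : ℝ) = (x / R) ^ c * s := rfl
    rw [h4, Real.mul_rpow (hmem x hx).1 s.2.1, hrc _ hx0, smul_smul, smul_smul]
    congr 2
    field_simp
  have h5 := congrArg (fun w : C(unitInterval, ℝ) => w 1) (primitive_rescale ⟨_, hmem x hx⟩ w)
  simp only [ContinuousMap.smul_apply, rescale_apply, mul_one, primitive_apply,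
    smul_eq_mul] at h5
  simp only [Function.comp]
  rw [weightedMean, h3, ← h5, primitive_apply, ← mul_assoc,
    ← Real.mul_rpow hR0.le hx0, mul_div_cancel₀ _ hR0.ne']

end Radial

/-! ### The Gauss lemma in normal coordinates -/

section Gauss

variable {n : ℕ}

theorem IsLorentzian.det_ne_zero {B : Form n} (h : IsLorentzian B) : B.det ≠ 0 := by
  obtain ⟨P, hP, h⟩ := h
  intro h0
  have h1 := congrArg Matrix.det h
  rw [Matrix.det_mul, Matrix.det_mul, h0, minkowski, Matrix.det_diagonal, Fin.prod_univ_succ] at h1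
  simp at h1

theorem IsLorentzian.isSymm {B : Form n} (h : IsLorentzian B) : B.IsSymm := by
  obtain ⟨P, hP, h⟩ := h
  have h1 : P.transpose * B.transpose * P = P.transpose * B * P := by
    have h2 := congrArg Matrix.transpose h
    rw [Matrix.transpose_mul, Matrix.transpose_mul, Matrix.transpose_transpose] at h2
    rw [h, Matrix.mul_assoc, h2, minkowski, Matrix.diagonal_transpose]
  have h3 := ((Matrix.isUnit_iff_isUnit_det P).2 hP).mul_right_cancel h1
  have hPt : IsUnit P.transpose :=
    (Matrix.isUnit_iff_isUnit_det _).2 (by rwa [Matrix.det_transpose])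
  exact hPt.mul_left_cancel h3

/-- The matrix of directional derivatives `∂_v C_{μν}`. -/
noncomputable def dForm (C : Spacetime n → Form n) (y v : Spacetime n) : Form n :=
  Matrix.of fun μ ν => fderiv ℝ (fun z => C z μ ν) y v

theorem sum_mul_pd (h : Spacetime n → ℝ) (y v : Spacetime n) :
    ∑ μ, v μ * pd μ h y = fderiv ℝ h y v := by
  conv_rhs => rw [← (EuclideanSpace.basisFun (Fin (n + 1)) ℝ).sum_repr v]
  simp [pd]

theorem eq_of_hasDerivAt_const {u : ℝ → ℝ} {c : ℝ} (hu : ContinuousOn u (Icc 0 1))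
    (hd : ∀ t ∈ Ioo (0 : ℝ) 1, HasDerivAt u c t) : u 1 = u 0 + c := by
  obtain ⟨t, -, h⟩ := exists_hasDerivAt_eq_slope u (fun _ => c) one_pos hu hd
  rw [h]
  ring

variable {C : Spacetime n → Form n} {U : Set (Spacetime n)}

/-- Lowering the free index of the radial geodesic equation removes C⁻¹, and the first two terms of
the Christoffel symbol coincide after contraction with y y. -/
theorem christoffel_contraction {y : Spacetime n} (hdet : (C y).det ≠ 0)
    (h : ∀ l, ∑ μ, ∑ ν, christoffel C y l μ ν * y μ * y ν = 0) (ρ : Fin (n + 1)) :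
    2 * ∑ ν, dForm C y y ρ ν * y ν = ∑ μ, ∑ ν, pd ρ (fun z => C z μ ν) y * y μ * y ν := by
  set S : Fin (n + 1) → ℝ := fun ρ => ∑ μ, ∑ ν, (pd μ (fun z => C z ρ ν) y +
    pd ν (fun z => C z ρ μ) y - pd ρ (fun z => C z μ ν) y) * y μ * y ν with hS
  have h1 : (C y)⁻¹.mulVec S = 0 := by
    ext l
    have h2 := h l
    simp only [christoffel] at h2
    simp only [Matrix.mulVec, dotProduct, hS, Pi.zero_apply]
    rw [← mul_zero 2, ← h2]
    simp only [Finset.mul_sum, Finset.sum_mul]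
    rw [Finset.sum_comm]
    refine Finset.sum_congr rfl fun μ _ => ?_
    rw [Finset.sum_comm]
    refine Finset.sum_congr rfl fun ν _ => Finset.sum_congr rfl fun ρ _ => ?_
    ring
  have h3 : S = 0 := by
    have h4 := congrArg (C y).mulVec h1
    rwa [Matrix.mulVec_mulVec, Matrix.mul_nonsing_inv _ (Ne.isUnit hdet), Matrix.one_mulVec,
      Matrix.mulVec_zero] at h4
  have h5 : ∑ μ, ∑ ν, pd μ (fun z => C z ρ ν) y * y μ * y ν = ∑ ν, dForm C y y ρ ν * y ν := by
    rw [Finset.sum_comm]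
    refine Finset.sum_congr rfl fun ν _ => ?_
    rw [dForm, Matrix.of_apply, ← sum_mul_pd, Finset.sum_mul]
    exact Finset.sum_congr rfl fun μ _ => by ring
  have h6 : ∑ μ, ∑ ν, pd ν (fun z => C z ρ μ) y * y μ * y ν = ∑ ν, dForm C y y ρ ν * y ν := by
    rw [← h5, Finset.sum_comm]
    exact Finset.sum_congr rfl fun μ _ => Finset.sum_congr rfl fun ν _ => by ring
  have h7 := congrFun h3 ρ
  simp only [hS, Pi.zero_apply, sub_mul, add_mul, Finset.sum_sub_distrib,
    Finset.sum_add_distrib, h5, h6] at h7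
  linarith

theorem hasDerivAt_component (hU : IsOpen U) {μ ν : Fin (n + 1)}
    (hd : DifferentiableOn ℝ (fun z => C z μ ν) U) {y : Spacetime n} {t : ℝ} (ht : t • y ∈ U) :
    HasDerivAt (fun t : ℝ => C (t • y) μ ν) (dForm C (t • y) y μ ν) t := by
  have h1 := (hd.differentiableAt (hU.mem_nhds ht)).hasFDerivAt
  have h2 : HasDerivAt (fun t : ℝ => t • y) y t := by
    simpa using (hasDerivAt_id t).smul_const y
  exact h1.comp_hasDerivAt t h2

theorem dForm_smul (y v : Spacetime n) (t : ℝ) (μ ν : Fin (n + 1)) :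
    dForm C y (t • v) μ ν = t * dForm C y v μ ν := by
  simp [dForm]

/-- The value of the metric on the radial vector. -/
theorem radial_energy (hU : IsStarNhd U)
    (hd : ∀ μ ν, DifferentiableOn ℝ (fun z => C z μ ν) U)
    (hL : ∀ z ∈ U, IsLorentzian (C z)) (hN : IsNormal C U) {y : Spacetime n} (hy : y ∈ U) :
    ∑ ρ, ∑ ν, C y ρ ν * y ρ * y ν = ∑ ρ, ∑ ν, minkowski n ρ ν * y ρ * y ν := by
  have hmem : ∀ t ∈ Icc (0 : ℝ) 1, t • y ∈ U := fun t ht =>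
    StarConvex.scale_mem hU.star hy ht.1 ht.2
  have h1 : ∀ t ∈ Icc (0 : ℝ) 1, HasDerivAt
      (fun t : ℝ => ∑ ρ, ∑ ν, C (t • y) ρ ν * y ρ * y ν)
      (∑ ρ, ∑ ν, dForm C (t • y) y ρ ν * y ρ * y ν) t := fun t ht =>
    HasDerivAt.fun_sum fun ρ _ => HasDerivAt.fun_sum fun ν _ =>
      ((hasDerivAt_component hU.isOpen (hd ρ ν) (hmem t ht)).mul_const _).mul_const _
  -- Contracting `christoffel_contraction` once more with the radial vector gives 2A = A for the
  -- radial derivative A of the energy, so A = 0.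
  have h2 : ∀ t ∈ Ioo (0 : ℝ) 1, ∑ ρ, ∑ ν, dForm C (t • y) y ρ ν * y ρ * y ν = 0 := fun t ht => by
    have ht' : t • y ∈ U := hmem t ⟨ht.1.le, ht.2.le⟩
    have h3 := christoffel_contraction (hL _ ht').det_ne_zero (hN.radial _ ht')
    have h4 : ∑ ρ, (t • y) ρ * ∑ μ, ∑ ν, pd ρ (fun z => C z μ ν) (t • y) * (t • y) μ * (t • y) ν =
        ∑ μ, ∑ ν, dForm C (t • y) (t • y) μ ν * (t • y) μ * (t • y) ν := by
      simp only [Finset.mul_sum]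
      rw [Finset.sum_comm]
      refine Finset.sum_congr rfl fun μ _ => ?_
      rw [Finset.sum_comm]
      refine Finset.sum_congr rfl fun ν _ => ?_
      rw [dForm, Matrix.of_apply, ← sum_mul_pd, Finset.sum_mul, Finset.sum_mul]
      exact Finset.sum_congr rfl fun ρ _ => by ring
    have h5 : ∑ ρ, (t • y) ρ * (2 * ∑ ν, dForm C (t • y) (t • y) ρ ν * (t • y) ν) =
        2 * ∑ μ, ∑ ν, dForm C (t • y) (t • y) μ ν * (t • y) μ * (t • y) ν := by
      simp only [Finset.mul_sum]
      exact Finset.sum_congr rfl fun μ _ => Finset.sum_congr rfl fun ν _ => by ring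
    simp only [h3, h4] at h5
    have h6 : ∑ μ, ∑ ν, dForm C (t • y) (t • y) μ ν * (t • y) μ * (t • y) ν =
        t ^ 3 * ∑ ρ, ∑ ν, dForm C (t • y) y ρ ν * y ρ * y ν := by
      simp only [Finset.mul_sum, dForm_smul, PiLp.smul_apply, smul_eq_mul]
      exact Finset.sum_congr rfl fun μ _ => Finset.sum_congr rfl fun ν _ => by ring
    have h7 : t ^ 3 * ∑ ρ, ∑ ν, dForm C (t • y) y ρ ν * y ρ * y ν = 0 := by linarith
    exact (mul_eq_zero.1 h7).resolve_left (pow_pos ht.1 3).ne'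
  have h8 := eq_of_hasDerivAt_const (fun t ht => (h1 t ht).continuousAt.continuousWithinAt)
    (fun t ht => (h1 t ⟨ht.1.le, ht.2.le⟩).congr_deriv (h2 t ht))
  simpa [hN.at_zero] using h8

theorem fderiv_quadratic_term {M : Spacetime n → Form n} {y : Spacetime n} {ρ ν : Fin (n + 1)}
    (hd : DifferentiableAt ℝ (fun z => M z ρ ν) y) :
    DifferentiableAt ℝ (fun z => M z ρ ν * z ρ * z ν) y ∧ ∀ v, fderiv ℝ
      (fun z => M z ρ ν * z ρ * z ν) y v =
        fderiv ℝ (fun z => M z ρ ν) y v * y ρ * y ν + M y ρ ν * v ρ * y ν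
          + M y ρ ν * y ρ * v ν := by
  have hc : ∀ ρ : Fin (n + 1), HasFDerivAt (fun z : Spacetime n => z ρ)
      (EuclideanSpace.proj ρ : Spacetime n →L[ℝ] ℝ) y :=
    fun ρ => (EuclideanSpace.proj ρ : Spacetime n →L[ℝ] ℝ).hasFDerivAt
  have h1 := (hd.hasFDerivAt.fun_mul (hc ρ)).fun_mul (hc ν)
  refine ⟨h1.differentiableAt, fun v => ?_⟩
  rw [h1.fderiv]
  simp
  ring

theorem pd_quadratic {M : Spacetime n → Form n} {y : Spacetime n}
    (hd : ∀ μ ν, DifferentiableAt ℝ (fun z => M z μ ν) y) (hs : (M y).IsSymm) (τ : Fin (n + 1)) :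
    pd τ (fun z => ∑ ρ, ∑ ν, M z ρ ν * z ρ * z ν) y =
      ∑ ρ, ∑ ν, pd τ (fun z => M z ρ ν) y * y ρ * y ν + 2 * ∑ ν, M y τ ν * y ν := by
  have h0 := fun ρ ν => fderiv_quadratic_term (hd ρ ν)
  have h1 : pd τ (fun z => ∑ ρ, ∑ ν, M z ρ ν * z ρ * z ν) y =
      ∑ ρ, ∑ ν, pd τ (fun z => M z ρ ν * z ρ * z ν) y := by
    rw [pd, fderiv_fun_sum fun ρ _ => DifferentiableAt.fun_sum fun ν _ => (h0 ρ ν).1]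
    simp only [_root_.sum_apply]
    refine Finset.sum_congr rfl fun ρ _ => ?_
    rw [fderiv_fun_sum fun ν _ => (h0 ρ ν).1]
    simp only [_root_.sum_apply]
    rfl
  have h2 : ∀ ρ ν, pd τ (fun z => M z ρ ν * z ρ * z ν) y = pd τ (fun z => M z ρ ν) y * y ρ * y ν +
      ((if ρ = τ then M y ρ ν * y ν else 0) + if ν = τ then M y ρ ν * y ρ else 0) := by
    intro ρ ν
    rw [pd, (h0 ρ ν).2, PiLp.single_apply, PiLp.single_apply]
    simp only [mul_ite, ite_mul, mul_one, mul_zero, zero_mul]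
    rw [pd]
    ring
  have h3 : ∑ ρ, ∑ ν, (if ρ = τ then M y ρ ν * y ν else 0) = ∑ ν, M y τ ν * y ν := by
    rw [Finset.sum_comm]
    simp
  have h4 : ∑ ρ, ∑ ν, (if ν = τ then M y ρ ν * y ρ else 0) = ∑ ν, M y τ ν * y ν := by
    simp only [Finset.sum_ite_eq', Finset.mem_univ, if_true]
    exact Finset.sum_congr rfl fun ρ _ => by rw [hs.apply]
  simp only [h1, h2, Finset.sum_add_distrib, h3, h4]
  ring

/-- The Gauss lemma: in normal coordinates `C_{μν} y^ν = η_{μν} y^ν`. -/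
theorem gauss_lemma (hU : IsStarNhd U)
    (hd : ∀ μ ν, DifferentiableOn ℝ (fun z => C z μ ν) U)
    (hL : ∀ z ∈ U, IsLorentzian (C z)) (hN : IsNormal C U) {y : Spacetime n} (hy : y ∈ U)
    (ρ : Fin (n + 1)) : ∑ ν, C y ρ ν * y ν = ∑ ν, minkowski n ρ ν * y ν := by
  have hmem : ∀ t ∈ Icc (0 : ℝ) 1, t • y ∈ U := fun t ht =>
    StarConvex.scale_mem hU.star hy ht.1 ht.2
  -- Differentiate the identity C(z)(z,z) = η(z,z) in z^ρ and eliminate ∂_ρ C with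
  -- `christoffel_contraction`. Along z = t y the result says that t C(t y) y has constant
  -- derivative η y.
  have h1 : ∀ z ∈ U, ∑ ν, dForm C z z ρ ν * z ν + ∑ ν, C z ρ ν * z ν =
      ∑ ν, minkowski n ρ ν * z ν := fun z hz => by
    have h2 := pd_quadratic (fun μ ν => (hd μ ν).differentiableAt (hU.isOpen.mem_nhds hz))
      (hL z hz).isSymm ρ
    have h3 := pd_quadratic (M := fun _ => minkowski n) (y := z)
      (fun μ ν => differentiableAt_const _) (Matrix.isSymm_diagonal _) ρ
    have h4 : pd ρ (fun z => ∑ ρ, ∑ ν, C z ρ ν * z ρ * z ν) z =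
        pd ρ (fun z => ∑ ρ, ∑ ν, minkowski n ρ ν * z ρ * z ν) z := by
      have h5 : (fun z => ∑ ρ, ∑ ν, C z ρ ν * z ρ * z ν) =ᶠ[𝓝 z]
          fun z => ∑ ρ, ∑ ν, minkowski n ρ ν * z ρ * z ν := by
        filter_upwards [hU.isOpen.mem_nhds hz] with w hw
        exact radial_energy hU hd hL hN hw
      rw [pd, pd, h5.fderiv_eq]
    have h6 := christoffel_contraction (hL _ hz).det_ne_zero (hN.radial _ hz) ρ
    rw [h2, h3, ← h6] at h4
    simp only [pd, fderiv_fun_const, Pi.zero_apply, zero_apply, zero_mul,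
      Finset.sum_const_zero, zero_add] at h4
    linarith
  have h2 : ∀ t ∈ Icc (0 : ℝ) 1, HasDerivAt (fun t : ℝ => ∑ ν, C (t • y) ρ ν * (t * y ν))
      (∑ ν, (dForm C (t • y) y ρ ν * (t * y ν) + C (t • y) ρ ν * y ν)) t := fun t ht =>
    HasDerivAt.fun_sum fun ν _ =>
      (hasDerivAt_component hU.isOpen (hd ρ ν) (hmem t ht)).mul (hasDerivAt_mul_const _)
  have h3 := eq_of_hasDerivAt_const (c := ∑ ν, minkowski n ρ ν * y ν)
    (fun t ht => (h2 t ht).continuousAt.continuousWithinAt)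
    (fun t ht => (h2 t ⟨ht.1.le, ht.2.le⟩).congr_deriv (by
      have h4 := h1 _ (hmem t ⟨ht.1.le, ht.2.le⟩)
      refine mul_left_cancel₀ ht.1.ne' ?_
      simp only [dForm_smul, PiLp.smul_apply, smul_eq_mul] at h4
      rw [← Finset.sum_add_distrib] at h4
      rw [Finset.mul_sum, Finset.mul_sum]
      convert h4 using 1
      · exact Finset.sum_congr rfl fun ν _ => by ring
      · exact Finset.sum_congr rfl fun ν _ => by ring))
  simpa using h3

theorem gauss_lemma_ray (hU : IsStarNhd U)
    (hd : ∀ μ ν, DifferentiableOn ℝ (fun z => C z μ ν) U)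
    (hL : ∀ z ∈ U, IsLorentzian (C z)) (hN : IsNormal C U) {g : Spacetime n} {r : ℝ}
    (hg : r • g ∈ U) (hr : 0 ≤ r) : (C (r • g)).mulVec g.ofLp = (minkowski n).mulVec g.ofLp := by
  rcases hr.eq_or_lt with h0 | h0
  · rw [← h0, zero_smul, hN.at_zero]
  ext ρ
  have h1 := gauss_lemma hU hd hL hN hg ρ
  refine mul_left_cancel₀ h0.ne' ?_
  simp only [PiLp.smul_apply, smul_eq_mul] at h1
  simp only [Matrix.mulVec, dotProduct, Finset.mul_sum]
  convert h1 using 1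
  · exact Finset.sum_congr rfl fun ν _ => by ring
  · exact Finset.sum_congr rfl fun ν _ => by ring

/-- C(t g) g does not depend on t by the Gauss lemma, so the radial derivative of C annihilates g.
This is what eliminates the null directions from the traces. -/
theorem dForm_mulVec_ray (hU : IsStarNhd U)
    (hd : ∀ μ ν, DifferentiableOn ℝ (fun z => C z μ ν) U)
    (hL : ∀ z ∈ U, IsLorentzian (C z)) (hN : IsNormal C U) {g : Spacetime n} {r : ℝ}
    (hg : r • g ∈ U) (hr : 0 < r) : (dForm C (r • g) g).mulVec g.ofLp = 0 := by
  ext ρ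
  have h1 : HasDerivAt (fun t : ℝ => ∑ ν, C (t • g) ρ ν * g ν)
      (∑ ν, dForm C (r • g) g ρ ν * g ν) r :=
    HasDerivAt.fun_sum fun ν _ =>
      (hasDerivAt_component hU.isOpen (hd ρ ν) hg).mul_const _
  have h2 : (fun t : ℝ => ∑ ν, C (t • g) ρ ν * g ν) =ᶠ[𝓝 r]
      fun _ => ∑ ν, minkowski n ρ ν * g ν := by
    have h3 : ∀ᶠ t in 𝓝 r, t • g ∈ U :=
      (Continuous.tendsto (by fun_prop : Continuous fun t : ℝ => t • g) r).eventually
        (hU.isOpen.mem_nhds hg)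
    filter_upwards [h3, lt_mem_nhds hr] with t ht ht0
    exact congrFun (gauss_lemma_ray hU hd hL hN ht ht0.le) ρ
  exact h1.unique ((hasDerivAt_const r _).congr_of_eventuallyEq h2)

theorem dForm_isSymm (hU : IsOpen U) (hL : ∀ z ∈ U, IsLorentzian (C z)) {y : Spacetime n}
    (hy : y ∈ U) (v : Spacetime n) : (dForm C y v).IsSymm := by
  ext μ ν
  simp only [dForm, Matrix.transpose_apply, Matrix.of_apply]
  have h : (fun z => C z ν μ) =ᶠ[𝓝 y] fun z => C z μ ν := by
    filter_upwards [hU.mem_nhds hy] with z hz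
    exact (hL z hz).isSymm.apply μ ν
  rw [h.fderiv_eq]

end Gauss

/-! ### Inverse metric in a null frame, and reduction of traces -/

section NullFrame

open Matrix

variable {ι κ : Type} [Fintype ι] [DecidableEq ι] [Fintype κ] [DecidableEq κ]
  {C X : Matrix ι ι ℝ} {L N w : ι → ℝ} {E : Matrix ι κ ℝ}

theorem dotProduct_mulVec_comm (hC : C.IsSymm) (u v : ι → ℝ) :
    u ⬝ᵥ C *ᵥ v = v ⬝ᵥ C *ᵥ u := by
  rw [dotProduct_mulVec, dotProduct_comm, ← mulVec_transpose, hC.eq]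

/-- Gram–Schmidt: subtracting the projection of N onto the columns of E gives orthogonality without
changing the product with L; a multiple of L then makes the vector null. -/
theorem exists_null_transversal (hC : C.IsSymm) (hLL : L ⬝ᵥ C *ᵥ L = 0)
    (hLE : Eᵀ *ᵥ (C *ᵥ L) = 0) (hLN : N ⬝ᵥ C *ᵥ L = 1) (hdet : IsUnit (Eᵀ * C * E).det) :
    ∃ w, w ⬝ᵥ C *ᵥ L = 1 ∧ w ⬝ᵥ C *ᵥ w = 0 ∧ Eᵀ *ᵥ (C *ᵥ w) = 0 := by
  set G := (Eᵀ * C * E)⁻¹ with hG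
  set N₁ := N - E *ᵥ (G *ᵥ (Eᵀ *ᵥ (C *ᵥ N))) with hN₁
  have h1 : Eᵀ *ᵥ (C *ᵥ N₁) = 0 := by
    have h2 : Eᵀ *ᵥ (C *ᵥ (E *ᵥ (G *ᵥ (Eᵀ *ᵥ (C *ᵥ N))))) = Eᵀ *ᵥ (C *ᵥ N) := by
      simp only [mulVec_mulVec]
      rw [← Matrix.mul_assoc Eᵀ C, ← Matrix.mul_assoc (Eᵀ * C) E,
        ← Matrix.mul_assoc (Eᵀ * C * E) G, hG, mul_nonsing_inv _ hdet, Matrix.one_mul]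
    rw [hN₁, mulVec_sub, mulVec_sub, h2, sub_self]
  have h3 : N₁ ⬝ᵥ C *ᵥ L = 1 := by
    have h4 : (E *ᵥ (G *ᵥ (Eᵀ *ᵥ (C *ᵥ N)))) ⬝ᵥ C *ᵥ L = 0 := by
      rw [dotProduct_comm, dotProduct_mulVec, ← mulVec_transpose, hLE, zero_dotProduct]
    rw [hN₁, sub_dotProduct, h4, hLN, sub_zero]
  set c := N₁ ⬝ᵥ C *ᵥ N₁ with hc
  refine ⟨N₁ - (c / 2) • L, ?_, ?_, ?_⟩
  · rw [sub_dotProduct, smul_dotProduct, hLL, h3, smul_zero, sub_zero]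
  · rw [mulVec_sub, mulVec_smul, sub_dotProduct, smul_dotProduct, dotProduct_sub, dotProduct_sub,
      dotProduct_smul, dotProduct_smul, hLL, h3, dotProduct_mulVec_comm hC L N₁, h3, ← hc]
    simp only [smul_eq_mul]
    ring
  · rw [mulVec_sub, mulVec_smul, mulVec_sub, mulVec_smul, h1, hLE, smul_zero, sub_zero]

theorem exists_inverse_decomposition (hcard : Fintype.card ι = Fintype.card κ + 2)
    (hC : C.IsSymm) (hLL : L ⬝ᵥ C *ᵥ L = 0)
    (hLE : Eᵀ *ᵥ (C *ᵥ L) = 0) (hLN : N ⬝ᵥ C *ᵥ L = 1) (hdet : IsUnit (Eᵀ * C * E).det) :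
    ∃ w, w ⬝ᵥ C *ᵥ L = 1 ∧
      C⁻¹ = E * (Eᵀ * C * E)⁻¹ * Eᵀ + (vecMulVec L w + vecMulVec w L) := by
  obtain ⟨w, hwL, hww, hwE⟩ := exists_null_transversal hC hLL hLE hLN hdet
  refine ⟨w, hwL, ?_⟩
  have hLw : L ⬝ᵥ C *ᵥ w = 1 := by rw [dotProduct_mulVec_comm hC, hwL]
  apply inv_eq_left_inv
  set G := (Eᵀ * C * E)⁻¹ with hG
  let A : Matrix ι (Fin 2) ℝ := of fun i j => ![L i, w i] j
  let B : Matrix (Fin 2) ι ℝ := of ![w, L]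
  have hAB : A * B = vecMulVec L w + vecMulVec w L := by
    ext i j
    simp [A, B, Matrix.mul_apply, Fin.sum_univ_two, vecMulVec_apply]
  have h11 : G * Eᵀ * C * E = 1 := by
    rw [Matrix.mul_assoc, Matrix.mul_assoc, ← Matrix.mul_assoc Eᵀ C E, hG,
      nonsing_inv_mul _ hdet]
  have hCA : Eᵀ * (C * A) = 0 := by
    ext a j
    fin_cases j
    · exact congrFun hLE a
    · exact congrFun hwE a
  have h12 : G * Eᵀ * C * A = 0 := by
    rw [Matrix.mul_assoc, Matrix.mul_assoc, hCA, Matrix.mul_zero]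
  -- For the null pair the dual basis is the swapped pair: w is dual to L, and L is dual to w.
  have hBt : B = Aᵀ.submatrix (Equiv.swap 0 1) id := by
    ext j i
    fin_cases j <;> simp [A, B]
  have h21 : B * C * E = 0 := by
    have h : (Eᵀ * (C * A))ᵀ = Aᵀ * C * E := by
      rw [transpose_mul, transpose_mul, transpose_transpose, hC.eq]
    rw [hCA, transpose_zero] at h
    rw [hBt]
    ext j a
    exact congrFun (congrFun h.symm (Equiv.swap 0 1 j)) a
  have hBCA : B * C * A = 1 := by
    have h : ∀ i j, (B * C * A) i j = (![w, L] i) ⬝ᵥ C *ᵥ (![L, w] j) := by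
      intro i j
      rw [Matrix.mul_assoc, Matrix.mul_apply]
      refine Finset.sum_congr rfl fun k _ => ?_
      congr 1
      rw [Matrix.mul_apply]
      refine Finset.sum_congr rfl fun l _ => ?_
      congr 1
      fin_cases j <;> rfl
    ext i j
    rw [h]
    fin_cases i <;> fin_cases j <;> simp [hwL, hww, hLL, hLw]
  -- The frame matrix is square by `hcard`, so this left inverse is also a right inverse, which is
  -- the completeness relation sought.
  have hone : fromRows (G * Eᵀ * C) (B * C) * fromCols E A = 1 := by
    rw [fromRows_mul_fromCols, h11, h12, h21, hBCA, fromBlocks_one]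
  rw [← fromCols_mul_fromRows_eq_one_comm (Fintype.equivOfCardEq (by simp [hcard])),
    fromCols_mul_fromRows] at hone
  rw [← hAB, ← hone, Matrix.add_mul]
  simp only [Matrix.mul_assoc]

theorem trace_inverse_mul (hXs : X.IsSymm) (hXL : X *ᵥ L = 0) {Z : Matrix κ κ ℝ}
    (hinv : C⁻¹ = E * Z * Eᵀ + (vecMulVec L w + vecMulVec w L)) :
    (C⁻¹ * X).trace = (Z * (Eᵀ * X * E)).trace := by
  have hLX : L ᵥ* X = 0 := by rw [← mulVec_transpose, hXs.eq, hXL]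
  rw [hinv, Matrix.add_mul, Matrix.add_mul, vecMulVec_mul, vecMulVec_mul, hLX, trace_add,
    trace_add, trace_vecMulVec, trace_vecMulVec, dotProduct_zero, add_zero,
    dotProduct_comm, ← dotProduct_mulVec, hXL, dotProduct_zero, add_zero, Matrix.mul_assoc,
    Matrix.mul_assoc, Matrix.trace_mul_comm]
  simp only [Matrix.mul_assoc]

theorem trace_inverse_mul_sq (hXs : X.IsSymm) (hXL : X *ᵥ L = 0) {Z : Matrix κ κ ℝ}
    (hinv : C⁻¹ = E * Z * Eᵀ + (vecMulVec L w + vecMulVec w L)) :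
    (C⁻¹ * X * (C⁻¹ * X)).trace = (Z * (Eᵀ * X * E) * (Z * (Eᵀ * X * E))).trace := by
  have hLX : L ᵥ* X = 0 := by rw [← mulVec_transpose, hXs.eq, hXL]
  have h1 : C⁻¹ * X = E * Z * Eᵀ * X + vecMulVec L (w ᵥ* X) := by
    rw [hinv, Matrix.add_mul, Matrix.add_mul, vecMulVec_mul, vecMulVec_mul, hLX,
      vecMulVec_zero, add_zero]
  have h2 : E * Z * Eᵀ * X * vecMulVec L (w ᵥ* X) = 0 := by
    rw [mul_vecMulVec, ← mulVec_mulVec, hXL, mulVec_zero, zero_vecMulVec]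
  have h3 : vecMulVec L (w ᵥ* X) * vecMulVec L (w ᵥ* X) = 0 := by
    rw [vecMulVec_mul, vecMul_vecMulVec, ← dotProduct_mulVec, hXL, dotProduct_zero]
    simp
  have h4 : (vecMulVec L (w ᵥ* X) * (E * Z * Eᵀ * X)).trace = 0 := by
    rw [Matrix.trace_mul_comm, h2, trace_zero]
  rw [h1, Matrix.add_mul, Matrix.mul_add, Matrix.mul_add, h2, h3, add_zero, add_zero, trace_add,
    h4, add_zero]
  have h5 : E * Z * Eᵀ * X * (E * Z * Eᵀ * X) = E * (Z * Eᵀ * X * (E * Z * Eᵀ * X)) := by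
    simp only [Matrix.mul_assoc]
  rw [h5, Matrix.trace_mul_comm]
  simp only [Matrix.mul_assoc]

/-- Used with X = η: each of the two null terms contributes 1. This is the origin of the -2 in
`roundTrace`. -/
theorem trace_inverse_mul_add_two (hXs : X.IsSymm) (hwX : w ⬝ᵥ X *ᵥ L = 1) {Z : Matrix κ κ ℝ}
    (hinv : C⁻¹ = E * Z * Eᵀ + (vecMulVec L w + vecMulVec w L)) :
    (C⁻¹ * X).trace = (Z * (Eᵀ * X * E)).trace + 2 := by
  have hLX : w ⬝ᵥ L ᵥ* X = 1 := by rw [← mulVec_transpose, hXs.eq, hwX]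
  rw [hinv, Matrix.add_mul, Matrix.add_mul, vecMulVec_mul, vecMulVec_mul, trace_add,
    trace_add, trace_vecMulVec, trace_vecMulVec, hLX, dotProduct_comm L, ← dotProduct_mulVec, hwX,
    Matrix.mul_assoc, Matrix.mul_assoc, Matrix.trace_mul_comm]
  simp only [Matrix.mul_assoc]
  norm_num

end NullFrame

/-! ### Riemannian character of the angular metric -/

section Positivity

open Matrix

variable {n : ℕ}

theorem minkowski_isSymm : (minkowski n).IsSymm := isSymm_diagonal _

theorem minkowski_isLorentzian : IsLorentzian (minkowski n) :=
  ⟨1, by simp, by simp⟩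

theorem dotProduct_minkowski (u v : Fin (n + 1) → ℝ) :
    u ⬝ᵥ minkowski n *ᵥ v = -(u 0 * v 0) + ∑ i : Fin n, u i.succ * v i.succ := by
  simp [minkowski, dotProduct, Fin.sum_univ_succ, mulVec_diagonal]

/-- A spacelike vector orthogonal to a null vector has positive square. -/
theorem IsLorentzian.pos_of_orthogonal {B : Form n} (hB : IsLorentzian B) {L x : Fin (n + 1) → ℝ}
    (hL : L 0 ≠ 0) (hx : x ≠ 0) (hx0 : x 0 = 0) (hLL : L ⬝ᵥ B *ᵥ L = 0)
    (hLx : L ⬝ᵥ B *ᵥ x = 0) : 0 < x ⬝ᵥ B *ᵥ x := by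
  obtain ⟨P, hP, hPB⟩ := hB
  have key : ∀ u v, u ⬝ᵥ B *ᵥ v = (P⁻¹ *ᵥ u) ⬝ᵥ minkowski n *ᵥ (P⁻¹ *ᵥ v) := by
    intro u v
    have h1 : B *ᵥ v = B *ᵥ (P *ᵥ (P⁻¹ *ᵥ v)) := by
      rw [mulVec_mulVec v, mul_nonsing_inv _ hP, one_mulVec]
    have h2 : u = P *ᵥ (P⁻¹ *ᵥ u) := by
      rw [mulVec_mulVec, mul_nonsing_inv _ hP, one_mulVec]
    rw [h1]
    conv_lhs => rw [h2]
    rw [← hPB, dotProduct_comm, dotProduct_mulVec, ← mulVec_transpose, dotProduct_comm]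
    simp only [mulVec_mulVec, Matrix.mul_assoc]
  rw [key] at hLL hLx ⊢
  set L' := P⁻¹ *ᵥ L with hL'
  set x' := P⁻¹ *ᵥ x with hx'
  have hLP : L = P *ᵥ L' := by rw [hL', mulVec_mulVec, mul_nonsing_inv _ hP, one_mulVec]
  have hxP : x = P *ᵥ x' := by rw [hx', mulVec_mulVec, mul_nonsing_inv _ hP, one_mulVec]
  rw [dotProduct_minkowski] at hLL hLx ⊢
  have hL0 : L' 0 ≠ 0 := by
    intro h0
    rw [h0] at hLL
    have h1 : ∑ i : Fin n, L' i.succ * L' i.succ = 0 := by linarith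
    rw [Finset.sum_eq_zero_iff_of_nonneg fun i _ => mul_self_nonneg _] at h1
    have h2 : L' = 0 := by
      ext μ
      refine Fin.cases h0 (fun i => ?_) μ
      exact mul_self_eq_zero.1 (h1 i (Finset.mem_univ i))
    rw [hLP, h2, mulVec_zero] at hL
    exact hL rfl
  set c := x' 0 / L' 0 with hc
  have hx'0 : x' 0 = c * L' 0 := by rw [hc, div_mul_cancel₀ _ hL0]
  -- Subtracting from x' the multiple of the null vector L' that kills its time component leaves its
  -- square unchanged, so the square is a Euclidean sum of squares. It vanishes only if x is
  -- proportional to L, which the time components exclude.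
  have h3 : -(x' 0 * x' 0) + ∑ i : Fin n, x' i.succ * x' i.succ =
      ∑ i : Fin n, (x' i.succ - c * L' i.succ) * (x' i.succ - c * L' i.succ) := by
    have h4 : ∑ i : Fin n, (x' i.succ - c * L' i.succ) * (x' i.succ - c * L' i.succ) =
        ∑ i : Fin n, x' i.succ * x' i.succ - 2 * c * ∑ i : Fin n, L' i.succ * x' i.succ +
          c ^ 2 * ∑ i : Fin n, L' i.succ * L' i.succ := by
      rw [Finset.mul_sum, Finset.mul_sum, ← Finset.sum_sub_distrib, ← Finset.sum_add_distrib]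
      exact Finset.sum_congr rfl fun i _ => by ring
    have h5 : ∑ i : Fin n, L' i.succ * x' i.succ = L' 0 * x' 0 := by linarith
    have h6 : ∑ i : Fin n, L' i.succ * L' i.succ = L' 0 * L' 0 := by linarith
    rw [h4, h5, h6, hx'0]
    ring
  rw [h3]
  refine lt_of_le_of_ne (Finset.sum_nonneg fun i _ => mul_self_nonneg _) fun h => ?_
  rw [eq_comm, Finset.sum_eq_zero_iff_of_nonneg fun i _ => mul_self_nonneg _] at h
  have h7 : x' = c • L' := by
    ext μ
    refine Fin.cases hx'0 (fun i => ?_) μ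
    exact sub_eq_zero.1 (mul_self_eq_zero.1 (h i (Finset.mem_univ i)))
  have h8 : x = c • L := by rw [hxP, h7, mulVec_smul, ← hLP]
  have h9 : c = 0 := by
    rw [h8, Pi.smul_apply, smul_eq_mul] at hx0
    exact (mul_eq_zero.1 hx0).resolve_right hL
  exact hx (by rw [h8, h9, zero_smul])

/-- The vectors `(0, e_A)` as the columns of a matrix. -/
def frameMat (e : Fin (n - 1) → EuclideanSpace ℝ (Fin n)) :
    Matrix (Fin (n + 1)) (Fin (n - 1)) ℝ :=
  of fun μ A => (Fin.cons 0 fun i => e A i : Fin (n + 1) → ℝ) μ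

@[simp] theorem frameMat_zero (e : Fin (n - 1) → EuclideanSpace ℝ (Fin n)) (A : Fin (n - 1)) :
    frameMat e 0 A = 0 := rfl

@[simp] theorem frameMat_succ (e : Fin (n - 1) → EuclideanSpace ℝ (Fin n)) (i : Fin n)
    (A : Fin (n - 1)) : frameMat e i.succ A = e A i := rfl

/-- The angular components `B_{AB}`. -/
def angular (B : Form n) (e : Fin (n - 1) → EuclideanSpace ℝ (Fin n)) : AForm n :=
  (frameMat e)ᵀ * B * frameMat e

theorem angular_apply (B : Form n) (e : Fin (n - 1) → EuclideanSpace ℝ (Fin n))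
    (A A' : Fin (n - 1)) :
    angular B e A A' = ∑ i : Fin n, ∑ j : Fin n, B i.succ j.succ * e A i * e A' j := by
  simp only [angular, Matrix.mul_apply, Matrix.transpose_apply, Fin.sum_univ_succ, frameMat_zero,
    frameMat_succ, zero_mul, mul_zero, zero_add, Finset.sum_mul, Finset.sum_const_zero]
  rw [Finset.sum_comm]
  exact Finset.sum_congr rfl fun i _ => Finset.sum_congr rfl fun j _ => by ring

theorem angular_minkowski (e : Fin (n - 1) → EuclideanSpace ℝ (Fin n)) :
    angular (minkowski n) e = roundMetric e := by
  ext A A'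
  rw [angular_apply]
  simp [roundMetric, minkowski, diagonal_apply]

theorem angular_isSymm {B : Form n} (hB : B.IsSymm) (e : Fin (n - 1) → EuclideanSpace ℝ (Fin n)) :
    (angular B e).IsSymm := by
  rw [IsSymm, angular, transpose_mul, transpose_mul, transpose_transpose, hB.eq, Matrix.mul_assoc]

theorem gam_eq (C : Spacetime n → Form n) (θ : EuclideanSpace ℝ (Fin n))
    (e : Fin (n - 1) → EuclideanSpace ℝ (Fin n)) (r : ℝ) :
    gam C θ e r = r ^ 2 • angular (C (r • gen θ)) e := by
  ext A A'
  simp [gam, angular_apply]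

variable {θ : EuclideanSpace ℝ (Fin n)} {e : Fin (n - 1) → EuclideanSpace ℝ (Fin n)}

@[simp] theorem gen_zero : gen θ 0 = 1 := rfl
@[simp] theorem gen_succ (i : Fin n) : gen θ i.succ = θ i := rfl

theorem sum_sq_of_norm_eq_one (hθ : ‖θ‖ = 1) : ∑ i, θ i * θ i = 1 := by
  have h := EuclideanSpace.real_norm_sq_eq θ
  rw [hθ] at h
  simp only [one_pow] at h
  rw [h]
  exact Finset.sum_congr rfl fun i _ => by ring

theorem gen_null (hθ : ‖θ‖ = 1) : (gen θ).ofLp ⬝ᵥ minkowski n *ᵥ (gen θ).ofLp = 0 := by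
  rw [dotProduct_minkowski]
  simp [sum_sq_of_norm_eq_one hθ]

theorem gen_transversal (hθ : ‖θ‖ = 1) :
    ((-1 / 2 : ℝ) • (gen (-θ)).ofLp) ⬝ᵥ minkowski n *ᵥ (gen θ).ofLp = 1 := by
  rw [smul_dotProduct, dotProduct_minkowski]
  simp [sum_sq_of_norm_eq_one hθ]
  norm_num

theorem frame_orthogonal (he : IsTangentFrame θ e) :
    (frameMat e)ᵀ *ᵥ (minkowski n *ᵥ (gen θ).ofLp) = 0 := by
  ext A
  have h := he.2 A
  have h1 : ((frameMat e)ᵀ *ᵥ (minkowski n *ᵥ (gen θ).ofLp)) A =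
      (fun μ => frameMat e μ A) ⬝ᵥ minkowski n *ᵥ (gen θ).ofLp := rfl
  rw [h1, dotProduct_minkowski]
  simp only [PiLp.inner_apply, RCLike.inner_apply, conj_trivial] at h
  simp only [frameMat_zero, frameMat_succ, gen_succ, zero_mul, neg_zero, zero_add, Pi.zero_apply]
  rw [← h]
  exact Finset.sum_congr rfl fun i _ => mul_comm _ _

theorem frame_mulVec_ne_zero (he : IsTangentFrame θ e) {v : Fin (n - 1) → ℝ} (hv : v ≠ 0) :
    frameMat e *ᵥ v ≠ 0 := by
  intro h
  apply hv
  ext A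
  refine Fintype.linearIndependent_iff.1 he.1 v ?_ A
  ext i
  have h1 := congrFun h i.succ
  simp only [mulVec, dotProduct, frameMat_succ, Pi.zero_apply] at h1
  simp only [WithLp.ofLp_sum, Finset.sum_apply, PiLp.smul_apply, smul_eq_mul, PiLp.zero_apply]
  rw [← h1]
  exact Finset.sum_congr rfl fun A _ => mul_comm _ _

/-- The metric induced on the angular directions is Riemannian. -/
theorem angular_posDef (hθ : ‖θ‖ = 1) (he : IsTangentFrame θ e) {B : Form n}
    (hB : IsLorentzian B) (hg : B *ᵥ (gen θ).ofLp = minkowski n *ᵥ (gen θ).ofLp) :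
    (angular B e).PosDef := by
  refine PosDef.of_dotProduct_mulVec_pos ?_ fun v hv => ?_
  · rw [IsHermitian, conjTranspose_eq_transpose_of_trivial]
    exact angular_isSymm hB.isSymm e
  have h1 : star v ⬝ᵥ angular B e *ᵥ v = (frameMat e *ᵥ v) ⬝ᵥ B *ᵥ (frameMat e *ᵥ v) := by
    rw [star_trivial, angular, ← mulVec_mulVec, ← mulVec_mulVec, dotProduct_mulVec,
      vecMul_transpose]
  rw [h1]
  refine hB.pos_of_orthogonal (L := (gen θ).ofLp) (by simp) (frame_mulVec_ne_zero he hv) ?_ ?_ ?_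
  · simp [mulVec, dotProduct]
  · rw [hg, gen_null hθ]
  · rw [dotProduct_mulVec_comm hB.isSymm, hg, dotProduct_comm, dotProduct_mulVec,
      ← mulVec_transpose, frame_orthogonal he, zero_dotProduct]

/-- The round metric is a Gram matrix WᵀW, so the trace is a sum of values of the positive form Z⁻¹.
Not all vanish, because n ≥ 2 supplies a frame vector, and it is nonzero. -/
theorem trace_inverse_round_pos (hn : 2 ≤ n) (he : IsTangentFrame θ e) {Z : AForm n}
    (hZ : Z.PosDef) : 0 < (Z⁻¹ * roundMetric e).trace := by
  have hZi := hZ.inv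
  let W : Matrix (Fin n) (Fin (n - 1)) ℝ := of fun i A => e A i
  have hW : roundMetric e = Wᵀ * W := by
    ext A B
    simp [roundMetric, W, Matrix.mul_apply]
  have h1 : (Z⁻¹ * roundMetric e).trace = ∑ i, W i ⬝ᵥ Z⁻¹ *ᵥ W i := by
    rw [hW, ← Matrix.mul_assoc, Matrix.trace_mul_comm, trace]
    refine Finset.sum_congr rfl fun i _ => ?_
    rw [diag_apply, Matrix.mul_apply]
    refine Finset.sum_congr rfl fun A _ => ?_
    rfl
  rw [h1]
  have h2 : ∀ i, 0 ≤ W i ⬝ᵥ Z⁻¹ *ᵥ W i := fun i => by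
    have := hZi.posSemidef.dotProduct_mulVec_nonneg (W i)
    simpa using this
  refine lt_of_le_of_ne (Finset.sum_nonneg fun i _ => h2 i) fun h => ?_
  rw [eq_comm, Finset.sum_eq_zero_iff_of_nonneg fun i _ => h2 i] at h
  refine he.1.ne_zero ⟨0, by omega⟩ ?_
  ext i
  by_contra h3
  have h4 : W i ≠ 0 := fun h5 => h3 (congrFun h5 ⟨0, by omega⟩)
  have h5 := hZi.dotProduct_mulVec_pos h4
  rw [star_trivial, h i (Finset.mem_univ i)] at h5
  exact lt_irrefl _ h5

end Positivity

/-! ### Entrywise regularity of matrix functions -/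

section MatrixSmooth

open Matrix

variable {E : Type} [NormedAddCommGroup E] [NormedSpace ℝ E] {ι : Type} [Fintype ι]
  [DecidableEq ι] {s : Set E} {k : WithTop ℕ∞} {M M' : E → Matrix ι ι ℝ}

/-- All entries of the matrix-valued function are of class `C^k`. -/
def EntriesContDiffOn (k : WithTop ℕ∞) (M : E → Matrix ι ι ℝ) (s : Set E) : Prop :=
  ∀ i j, ContDiffOn ℝ k (fun x => M x i j) s

theorem EntriesContDiffOn.det (hM : EntriesContDiffOn k M s) :
    ContDiffOn ℝ k (fun x => (M x).det) s := by
  simp only [Matrix.det_apply]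
  exact ContDiffOn.sum fun σ _ => (contDiffOn_prod fun i _ => hM (σ i) i).const_smul _

theorem EntriesContDiffOn.mul (hM : EntriesContDiffOn k M s) (hM' : EntriesContDiffOn k M' s) :
    EntriesContDiffOn k (fun x => M x * M' x) s := by
  intro i j
  simp only [Matrix.mul_apply]
  exact ContDiffOn.sum fun l _ => (hM i l).mul (hM' l j)

theorem EntriesContDiffOn.trace (hM : EntriesContDiffOn k M s) :
    ContDiffOn ℝ k (fun x => (M x).trace) s :=
  ContDiffOn.sum fun i _ => hM i i

/-- Cramer's rule expresses each entry of the inverse as a quotient of determinants. -/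
theorem EntriesContDiffOn.inv (hM : EntriesContDiffOn k M s) (h0 : ∀ x ∈ s, (M x).det ≠ 0) :
    EntriesContDiffOn k (fun x => (M x)⁻¹) s := by
  intro i j
  have h1 : EntriesContDiffOn k (fun x => (M x).updateRow j (Pi.single i 1)) s := by
    intro i' j'
    by_cases h : i' = j
    · subst h
      simp only [updateRow_self]
      exact contDiffOn_const
    · simp only [updateRow_ne h]
      exact hM i' j'
  have h2 := (hM.det.inv h0).mul h1.det
  refine h2.congr fun x _ => ?_
  change (M x)⁻¹ i j = (M x).det⁻¹ * _
  rw [Matrix.inv_def, Matrix.smul_apply, adjugate_apply, Ring.inverse_eq_inv', smul_eq_mul]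

end MatrixSmooth

/-! ### The coefficients of the linear equation as radial families -/

section Coefficients

open Matrix

variable {n : ℕ} {C : Spacetime n → Form n} {U : Set (Spacetime n)} {k : ℕ∞}

/-- `C^{μν} ∂_v C_{μν}`. -/
noncomputable def logDet (C : Spacetime n → Form n) (z v : Spacetime n) : ℝ :=
  ((C z)⁻¹ * dForm C z v).trace

/-- `|σ|² / (n - 1)` along the radial direction `v`. -/
noncomputable def shearCoeff (C : Spacetime n → Form n) (z v : Spacetime n) : ℝ :=
  (((C z)⁻¹ * dForm C z v * ((C z)⁻¹ * dForm C z v)).trace / 4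
    - logDet C z v ^ 2 / 4 / ((n : ℝ) - 1)) / ((n : ℝ) - 1)

/-- `C^{μν} η_{μν} - 2`, on the cone equal to the trace of the round metric. -/
noncomputable def roundTrace (C : Spacetime n → Form n) (z : Spacetime n) : ℝ :=
  ((C z)⁻¹ * minkowski n).trace - 2

theorem roundTrace_contDiffOn (hC : ∀ μ ν, ContDiffOn ℝ k (fun y => C y μ ν) U)
    (hL : ∀ z ∈ U, IsLorentzian (C z)) : ContDiffOn ℝ k (roundTrace C) U := by
  have h1 : EntriesContDiffOn k C U := hC
  have h2 : EntriesContDiffOn k (fun _ : Spacetime n => minkowski n) U :=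
    fun _ _ => contDiffOn_const
  exact ((h1.inv fun z hz => (hL z hz).det_ne_zero).mul h2).trace.sub contDiffOn_const

theorem dForm_contDiffOn (hU : IsOpen U)
    (hC : ∀ μ ν, ContDiffOn ℝ ((k + 1 : ℕ∞) : WithTop ℕ∞) (fun y => C y μ ν) U) :
    EntriesContDiffOn k (fun p : Spacetime n × Spacetime n => dForm C p.1 p.2) (U ×ˢ univ) := by
  intro μ ν
  have h1 := hC μ ν
  push_cast at h1
  rw [contDiffOn_succ_iff_fderiv_of_isOpen hU] at h1
  have h2 : ContDiffOn ℝ k (fun p : Spacetime n × Spacetime n =>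
      fderiv ℝ (fun z => C z μ ν) p.1) (U ×ˢ univ) :=
    h1.2.2.comp contDiff_fst.contDiffOn fun p hp => hp.1
  exact h2.clm_apply contDiff_snd.contDiffOn

theorem logDeriv_contDiffOn (hU : IsOpen U)
    (hC : ∀ μ ν, ContDiffOn ℝ ((k + 1 : ℕ∞) : WithTop ℕ∞) (fun y => C y μ ν) U)
    (hL : ∀ z ∈ U, IsLorentzian (C z)) :
    EntriesContDiffOn k (fun p : Spacetime n × Spacetime n => (C p.1)⁻¹ * dForm C p.1 p.2)
      (U ×ˢ univ) := by
  refine EntriesContDiffOn.mul (EntriesContDiffOn.inv ?_ fun p hp => (hL p.1 hp.1).det_ne_zero)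
    (dForm_contDiffOn hU hC)
  intro μ ν
  refine ((hC μ ν).of_le ?_).comp contDiff_fst.contDiffOn fun p hp => hp.1
  exact_mod_cast le_self_add

theorem logDet_contDiffOn (hU : IsOpen U)
    (hC : ∀ μ ν, ContDiffOn ℝ ((k + 1 : ℕ∞) : WithTop ℕ∞) (fun y => C y μ ν) U)
    (hL : ∀ z ∈ U, IsLorentzian (C z)) :
    ContDiffOn ℝ k (fun p : Spacetime n × Spacetime n => logDet C p.1 p.2) (U ×ˢ univ) :=
  (logDeriv_contDiffOn hU hC hL).trace

theorem shearCoeff_contDiffOn (hU : IsOpen U)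
    (hC : ∀ μ ν, ContDiffOn ℝ ((k + 1 : ℕ∞) : WithTop ℕ∞) (fun y => C y μ ν) U)
    (hL : ∀ z ∈ U, IsLorentzian (C z)) :
    ContDiffOn ℝ k (fun p : Spacetime n × Spacetime n => shearCoeff C p.1 p.2) (U ×ˢ univ) := by
  have h1 := logDeriv_contDiffOn hU hC hL
  exact ((((h1.mul h1).trace).div_const _).sub
    ((((logDet_contDiffOn hU hC hL).pow 2).div_const _).div_const _)).div_const _

theorem dForm_smul_eq (z v : Spacetime n) (r : ℝ) : dForm C z (r • v) = r • dForm C z v := by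
  ext μ ν
  rw [dForm_smul]
  rfl

theorem logDet_smul (z v : Spacetime n) (r : ℝ) : logDet C z (r • v) = r * logDet C z v := by
  simp [logDet, dForm_smul_eq]

theorem shearCoeff_smul (z v : Spacetime n) (r : ℝ) :
    shearCoeff C z (r • v) = r ^ 2 * shearCoeff C z v := by
  simp only [shearCoeff, logDet_smul, dForm_smul_eq, mul_smul_comm, smul_mul_assoc, trace_smul,
    smul_eq_mul]
  ring

variable {E : Type} [NormedAddCommGroup E] [NormedSpace ℝ E]

/-- For fixed t the pair (t y, y) depends linearly on y, so the substitution theorem applies. The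
case k = ∞ reduces to finite orders. -/
theorem radialFamily_of_contDiffOn {U : Set E} (hU : IsOpen U) (hs : StarConvex ℝ 0 U) {p : ℕ}
    {h : E → E → ℝ} (hh : ContDiffOn ℝ k (fun q : E × E => h q.1 q.2) (U ×ˢ univ))
    (hp : ∀ z v r, h z (r • v) = r ^ p * h z v) :
    RadialFamily U k p (fun t y => h (t • y) y) := by
  have hl : Continuous fun t : unitInterval =>
      ((t : ℝ) • ContinuousLinearMap.id ℝ E).prod (ContinuousLinearMap.id ℝ E) := by
    have h1 : Continuous fun t : unitInterval => (t : ℝ) • ContinuousLinearMap.id ℝ E := by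
      fun_prop
    exact (ContinuousLinearMap.prodₗᵢ (𝕜 := ℝ) (E := E) (F := E) (G := E) ℝ).continuous.comp
      (h1.prodMk continuous_const)
  have hmem : ∀ t : unitInterval, ∀ y ∈ U,
      ((t : ℝ) • ContinuousLinearMap.id ℝ E).prod (ContinuousLinearMap.id ℝ E) y ∈
        U ×ˢ (univ : Set E) :=
    fun t y hy => ⟨StarConvex.scale_mem hs hy t.2.1 t.2.2, mem_univ _⟩
  refine ⟨fun y hy => ?_, ?_, fun t r y _ => ?_⟩
  · exact slice_continuous (f := fun (t : unitInterval) y => h ((t : ℝ) • y) y)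
      (substitution_continuousOn (A := fun _ : unitInterval =>
      ContinuousLinearMap.id ℝ ℝ) hh.continuousOn hl continuous_const hmem) hy
  · rw [contDiffOn_iff_forall_nat_le] at hh ⊢
    intro j hj
    exact bundle_substitution_contDiffOn hU (hU.prod isOpen_univ) hl hmem j
      (A := fun _ => ContinuousLinearMap.id ℝ ℝ) continuous_const (hh j hj)
  · simp only [smul_smul]
    rw [hp, mul_comm t r]

theorem radialFamily_quotient {U : Set E} (hU : IsOpen U) (hs : StarConvex ℝ 0 U)
    {K : E → ℝ} (hK : ContDiffOn ℝ k K U)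
    (hO : Asymptotics.IsBigO (𝓝 0) K (fun y => ‖y‖ ^ 2)) :
    RadialFamily U k 1 (fun t y => K (t • y) / t) := by
  have h0 : K 0 = 0 := by
    obtain ⟨c, hc⟩ := hO.bound
    simpa using hc.self_of_nhds
  refine ⟨fun y hy => slice_continuous
    (f := fun (t : unitInterval) y => K ((t : ℝ) • y) / (t : ℝ)) (quotient_continuousOn hU hs hK.continuousOn hO) hy, ?_,
    fun t r y _ => ?_⟩
  · rw [contDiffOn_iff_forall_nat_le] at hK ⊢
    exact fun j hj => bundle_quotient_contDiffOn hU hs (hK j hj) hO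
  · rw [smul_smul, mul_comm t r, pow_one]
    by_cases hr : r = 0
    · simp [hr, h0]
    · field_simp

end Coefficients

/-! ### Divergence, shear and source term along one generator -/

section Ray

open Matrix

variable {n : ℕ} {C : Spacetime n → Form n} {U : Set (Spacetime n)}
  {θ : EuclideanSpace ℝ (Fin n)} {e : Fin (n - 1) → EuclideanSpace ℝ (Fin n)} {r : ℝ}

theorem card_angular (hn : 2 ≤ n) : ((Fintype.card (Fin (n - 1)) : ℕ) : ℝ) = (n : ℝ) - 1 := by
  rw [Fintype.card_fin, Nat.cast_sub (by omega), Nat.cast_one]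

theorem dr_smul {f : ℝ → ℝ} {f' : ℝ} {M : ℝ → AForm n} {M' : AForm n} (hf : HasDerivAt f f' r)
    (hM : ∀ A B, HasDerivAt (fun s => M s A B) (M' A B) r) :
    dr (fun s => f s • M s) r = f' • M r + f r • M' := by
  ext A B
  exact (hf.mul (hM A B)).deriv

theorem divergence_smul (hn : 2 ≤ n) {f : ℝ → ℝ} {f' : ℝ} {M : ℝ → AForm n} {M' : AForm n}
    (hf : HasDerivAt f f' r) (hM : ∀ A B, HasDerivAt (fun s => M s A B) (M' A B) r)
    (hf0 : f r ≠ 0) (hdet : IsUnit (M r).det) (hs : (M r).IsSymm) (hs' : M'.IsSymm) :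
    divergence (fun s => f s • M s) r =
      1 / 2 * (((n : ℝ) - 1) * (f' / f r) + ((M r)⁻¹ * M').trace) := by
  rw [divergence, dr_smul hf hM]
  congr 1
  have h1 : (f' • M r + f r • M').IsSymm := (hs.smul _).add (hs'.smul _)
  have h2 : ∑ A, ∑ B, (f r • M r)⁻¹ A B * (f' • M r + f r • M') A B =
      ((f r • M r)⁻¹ * (f' • M r + f r • M')).trace := by
    refine Finset.sum_congr rfl fun A _ => ?_
    rw [diag_apply, Matrix.mul_apply]
    exact Finset.sum_congr rfl fun B _ => by rw [h1.apply]
  have h3 : (f r • M r)⁻¹ = (f r)⁻¹ • (M r)⁻¹ := by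
    have := Matrix.inv_smul' (A := M r) (Units.mk0 _ hf0) hdet
    simpa [Units.smul_def] using this
  rw [h2, h3, Matrix.mul_add, trace_add, smul_mul_smul_comm, smul_mul_smul_comm,
    nonsing_inv_mul _ hdet, trace_smul, trace_smul, trace_one, card_angular hn,
    inv_mul_cancel₀ hf0]
  simp only [smul_eq_mul, one_mul]
  ring

theorem trace_traceless_sq (hn : 2 ≤ n) (c : ℝ) (Y : AForm n) :
    ((Y + c • (1 : AForm n) - ((Y + c • (1 : AForm n)).trace / ((n : ℝ) - 1)) • (1 : AForm n)) *
      (Y + c • (1 : AForm n) -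
        ((Y + c • (1 : AForm n)).trace / ((n : ℝ) - 1)) • (1 : AForm n))).trace =
      (Y * Y).trace - Y.trace ^ 2 / ((n : ℝ) - 1) := by
  have hm : (n : ℝ) - 1 ≠ 0 := by
    have : (2 : ℝ) ≤ n := by exact_mod_cast hn
    linarith
  have h1 : Y + c • (1 : AForm n) -
      ((Y + c • (1 : AForm n)).trace / ((n : ℝ) - 1)) • (1 : AForm n) =
      Y - (Y.trace / ((n : ℝ) - 1)) • (1 : AForm n) := by
    rw [trace_add, trace_smul, trace_one, card_angular hn, add_sub_assoc, ← sub_smul,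
      sub_eq_add_neg Y, ← neg_smul]
    congr 2
    rw [smul_eq_mul]
    field_simp
    ring
  rw [h1, Matrix.sub_mul, Matrix.mul_sub, Matrix.mul_sub]
  simp only [smul_mul_assoc, mul_smul_comm, Matrix.one_mul, Matrix.mul_one, trace_sub, trace_smul,
    trace_one, card_angular hn, smul_eq_mul]
  field_simp
  ring

/-- Conformal invariance of the shear: f changes ½ h⁻¹h' only by a multiple of the identity, which
the traceless part discards. The factor r² in γ therefore contributes no singularity at the vertex.
-/
theorem shearSq_smul (hn : 2 ≤ n) {f : ℝ → ℝ} {f' : ℝ} {M : ℝ → AForm n} {M' : AForm n}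
    (hf : HasDerivAt f f' r) (hM : ∀ A B, HasDerivAt (fun s => M s A B) (M' A B) r)
    (hf0 : f r ≠ 0) (hdet : IsUnit (M r).det) :
    shearSq (fun s => f s • M s) r =
      ((M r)⁻¹ * M' * ((M r)⁻¹ * M')).trace / 4
        - ((M r)⁻¹ * M').trace ^ 2 / 4 / ((n : ℝ) - 1) := by
  have h3 : (f r • M r)⁻¹ = (f r)⁻¹ • (M r)⁻¹ := by
    have := Matrix.inv_smul' (A := M r) (Units.mk0 _ hf0) hdet
    simpa [Units.smul_def] using this
  have h4 : (1 / 2 : ℝ) • (dr (fun s => f s • M s) r * (f r • M r)⁻¹) =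
      (1 / 2 : ℝ) • (M' * (M r)⁻¹) + (1 / 2 * (f' / f r)) • (1 : AForm n) := by
    rw [dr_smul hf hM, h3, Matrix.add_mul, smul_mul_smul_comm, smul_mul_smul_comm,
      mul_nonsing_inv _ hdet, mul_inv_cancel₀ hf0, one_smul, smul_add, smul_smul, add_comm]
    rfl
  have h5 : shearSq (fun s => f s • M s) r =
      (shear (fun s => f s • M s) r * shear (fun s => f s • M s) r).trace := by
    refine Finset.sum_congr rfl fun A _ => ?_
    rw [diag_apply, Matrix.mul_apply]
  rw [h5, shear, h4, trace_traceless_sq hn]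
  have h6 : (M' * (M r)⁻¹ * (M' * (M r)⁻¹)).trace = ((M r)⁻¹ * M' * ((M r)⁻¹ * M')).trace := by
    rw [Matrix.mul_assoc, Matrix.trace_mul_comm]
    simp only [Matrix.mul_assoc]
  rw [smul_mul_smul_comm, trace_smul, trace_smul, h6, Matrix.trace_mul_comm M']
  simp only [smul_eq_mul]
  ring

/-- The data of the problem at a point of a generator. -/
structure RayPoint (C : Spacetime n → Form n) (U : Set (Spacetime n))
    (θ : EuclideanSpace ℝ (Fin n)) (r : ℝ) : Prop where
  dim : 2 ≤ n
  nhd : IsStarNhd U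
  diff : ∀ μ ν, DifferentiableOn ℝ (fun z => C z μ ν) U
  lorentzian : ∀ z ∈ U, IsLorentzian (C z)
  normal : IsNormal C U
  norm : ‖θ‖ = 1
  pos : 0 < r
  mem : r • gen θ ∈ U

namespace RayPoint

variable (hp : RayPoint C U θ r)

include hp

theorem gauss : C (r • gen θ) *ᵥ (gen θ).ofLp = minkowski n *ᵥ (gen θ).ofLp :=
  gauss_lemma_ray hp.nhd hp.diff hp.lorentzian hp.normal hp.mem hp.pos.le

theorem posDef (he : IsTangentFrame θ e) : (angular (C (r • gen θ)) e).PosDef :=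
  angular_posDef hp.norm he (hp.lorentzian _ hp.mem) hp.gauss

theorem isUnit_det (he : IsTangentFrame θ e) : IsUnit (angular (C (r • gen θ)) e).det :=
  (hp.posDef he).det_pos.ne'.isUnit

theorem symm : (C (r • gen θ)).IsSymm := (hp.lorentzian _ hp.mem).isSymm

theorem dForm_symm : (dForm C (r • gen θ) (gen θ)).IsSymm :=
  dForm_isSymm hp.nhd.isOpen hp.lorentzian hp.mem _

theorem angular_hasDerivAt (A B : Fin (n - 1)) :
    HasDerivAt (fun s : ℝ => angular (C (s • gen θ)) e A B)
      (angular (dForm C (r • gen θ) (gen θ)) e A B) r := by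
  simp only [angular_apply]
  exact HasDerivAt.fun_sum fun i _ => HasDerivAt.fun_sum fun j _ =>
    ((hasDerivAt_component hp.nhd.isOpen (hp.diff _ _) hp.mem).mul_const _).mul_const _

/-- The vector -½(1, -θ) has η-product 1 with (1, θ). The Gauss lemma carries this and the other
products with the generator from η over to C. -/
theorem decomposition (he : IsTangentFrame θ e) :
    ∃ w, w ⬝ᵥ C (r • gen θ) *ᵥ (gen θ).ofLp = 1 ∧
      (C (r • gen θ))⁻¹ = frameMat e * (angular (C (r • gen θ)) e)⁻¹ * (frameMat e)ᵀ +
        (vecMulVec (gen θ).ofLp w + vecMulVec w (gen θ).ofLp) := by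
  have hg := hp.gauss
  refine exists_inverse_decomposition (N := (-1 / 2 : ℝ) • (gen (-θ)).ofLp) ?_ hp.symm ?_ ?_ ?_
    (hp.isUnit_det he)
  · have := hp.dim
    simp only [Fintype.card_fin]
    omega
  · rw [hg, gen_null hp.norm]
  · rw [hg, frame_orthogonal he]
  · rw [hg, gen_transversal hp.norm]

theorem trace_eq_logDet (he : IsTangentFrame θ e) :
    ((angular (C (r • gen θ)) e)⁻¹ * angular (dForm C (r • gen θ) (gen θ)) e).trace =
      logDet C (r • gen θ) (gen θ) := by
  obtain ⟨w, -, hinv⟩ := hp.decomposition he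
  exact (trace_inverse_mul hp.dForm_symm (dForm_mulVec_ray hp.nhd hp.diff hp.lorentzian hp.normal
    hp.mem hp.pos) hinv).symm

theorem shearSq_eq (he : IsTangentFrame θ e) :
    shearSq (gam C θ e) r = ((n : ℝ) - 1) * shearCoeff C (r • gen θ) (gen θ) := by
  obtain ⟨w, -, hinv⟩ := hp.decomposition he
  have hm : (n : ℝ) - 1 ≠ 0 := by
    have : (2 : ℝ) ≤ n := by exact_mod_cast hp.dim
    linarith
  have h1 : gam C θ e = fun s => s ^ 2 • angular (C (s • gen θ)) e := funext (gam_eq C θ e)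
  have h2 : HasDerivAt (fun s : ℝ => s ^ 2) (2 * r) r := by simpa using hasDerivAt_pow 2 r
  rw [h1, shearSq_smul hp.dim h2 (hp.angular_hasDerivAt) (pow_pos hp.pos 2).ne'
    (hp.isUnit_det he), hp.trace_eq_logDet he, shearCoeff,
    trace_inverse_mul_sq hp.dForm_symm (dForm_mulVec_ray hp.nhd hp.diff hp.lorentzian hp.normal
    hp.mem hp.pos) hinv, mul_div_cancel₀ _ hm]
  rfl

theorem gbar_eq (Ω : Spacetime n → ℝ) (s : ℝ) :
    gbar C Ω θ e s = (Ω (s • gen θ) * s) ^ 2 • angular (C (s • gen θ)) e := by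
  rw [gbar, gam_eq, smul_smul, mul_pow]

theorem divergence_eq (he : IsTangentFrame θ e) {Ω : Spacetime n → ℝ} {Ω' : ℝ}
    (hΩ : HasDerivAt (fun s : ℝ => Ω (s • gen θ)) Ω' r) (hΩ0 : Ω (r • gen θ) ≠ 0) :
    divergence (gbar C Ω θ e) r = ((n : ℝ) - 1) * (Ω' / Ω (r • gen θ) + 1 / r)
      + logDet C (r • gen θ) (gen θ) / 2 := by
  have h1 : gbar C Ω θ e = fun s => (Ω (s • gen θ) * s) ^ 2 • angular (C (s • gen θ)) e :=
    funext (hp.gbar_eq Ω)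
  have hr := hp.pos.ne'
  have h2 := (hΩ.fun_mul (hasDerivAt_id' r)).fun_pow 2
  rw [h1, divergence_smul hp.dim h2 hp.angular_hasDerivAt (pow_ne_zero 2 (mul_ne_zero hΩ0 hr))
    (hp.isUnit_det he) (angular_isSymm hp.symm e) (angular_isSymm hp.dForm_symm e),
    hp.trace_eq_logDet he]
  field_simp
  ring

theorem trace_round (he : IsTangentFrame θ e) :
    ((angular (C (r • gen θ)) e)⁻¹ * roundMetric e).trace = roundTrace C (r • gen θ) := by
  obtain ⟨w, hw, hinv⟩ := hp.decomposition he
  rw [hp.gauss] at hw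
  rw [roundTrace, trace_inverse_mul_add_two minkowski_isSymm hw hinv, ← angular_minkowski]
  simp only [angular]
  ring

theorem roundTrace_pos (he : IsTangentFrame θ e) : 0 < roundTrace C (r • gen θ) := by
  rw [← hp.trace_round he]
  exact trace_inverse_round_pos hp.dim he (hp.posDef he)

theorem source_eq (he : IsTangentFrame θ e) {Ω : Spacetime n → ℝ} (hΩ0 : Ω (r • gen θ) ≠ 0) :
    ∑ A, ∑ B, (gbar C Ω θ e r)⁻¹ A B * (r * roundMetric e A B) =
      roundTrace C (r • gen θ) / (Ω (r • gen θ) ^ 2 * r) := by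
  have hf0 : (Ω (r • gen θ) * r) ^ 2 ≠ 0 := pow_ne_zero 2 (mul_ne_zero hΩ0 hp.pos.ne')
  have hr := hp.pos.ne'
  have h3 : (gbar C Ω θ e r)⁻¹ =
      ((Ω (r • gen θ) * r) ^ 2)⁻¹ • (angular (C (r • gen θ)) e)⁻¹ := by
    rw [hp.gbar_eq]
    have := Matrix.inv_smul' (A := angular (C (r • gen θ)) e) (Units.mk0 _ hf0) (hp.isUnit_det he)
    simpa [Units.smul_def] using this
  have h4 : ∑ A, ∑ B, (gbar C Ω θ e r)⁻¹ A B * (r * roundMetric e A B) =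
      r * ((gbar C Ω θ e r)⁻¹ * roundMetric e).trace := by
    rw [trace, Finset.mul_sum]
    refine Finset.sum_congr rfl fun A _ => ?_
    rw [diag_apply, Matrix.mul_apply, Finset.mul_sum]
    refine Finset.sum_congr rfl fun B _ => ?_
    rw [show roundMetric e B A = roundMetric e A B from by
      simp only [roundMetric, of_apply]
      exact Finset.sum_congr rfl fun i _ => mul_comm _ _]
    ring
  rw [h4, h3, smul_mul_assoc, trace_smul, hp.trace_round he, smul_eq_mul]
  field_simp

end RayPoint

end Ray

/-! ### Uniqueness for the linear second-order equation -/

section OneDimensional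

variable {R : ℝ}

theorem eq_of_hasDerivAt_zero {u : ℝ → ℝ} (hd : ∀ r ∈ Ioo 0 R, HasDerivAt u 0 r) {x y : ℝ}
    (hx : x ∈ Ioo 0 R) (hy : y ∈ Ioo 0 R) : u x = u y := by
  wlog hxy : x < y generalizing x y
  · rcases (not_lt.1 hxy).eq_or_lt with h | h
    · rw [h]
    · exact (this hy hx h).symm
  have hsub : ∀ z ∈ Icc x y, z ∈ Ioo 0 R := fun z hz =>
    ⟨hx.1.trans_le hz.1, hz.2.trans_lt hy.2⟩
  obtain ⟨ξ, -, h⟩ := exists_hasDerivAt_eq_slope u (fun _ => 0) hxy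
    (fun z hz => (hd z (hsub z hz)).continuousAt.continuousWithinAt)
    (fun z hz => hd z (hsub z ⟨hz.1.le, hz.2.le⟩))
  have h1 : y - x ≠ 0 := (sub_pos.2 hxy).ne'
  field_simp at h
  linarith

theorem eq_limit_of_hasDerivAt_zero {u : ℝ → ℝ} {l : ℝ}
    (hd : ∀ r ∈ Ioo 0 R, HasDerivAt u 0 r) (hl : Tendsto u (𝓝[>] 0) (𝓝 l)) {x : ℝ}
    (hx : x ∈ Ioo 0 R) : u x = l := by
  refine tendsto_nhds_unique (f := u) (Tendsto.congr' ?_ tendsto_const_nhds) hl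
  filter_upwards [Ioo_mem_nhdsGT (hx.1.trans hx.2)] with y hy
  exact eq_of_hasDerivAt_zero hd hx hy

/-- A positive solution `φ` of `φ'' = κ φ' - b φ` is determined by `φ / r → 1`. -/
theorem eq_of_second_order {φ φ₁ q q₁ G κ b : ℝ → ℝ}
    (hφ : ∀ r ∈ Ioo 0 R, HasDerivAt φ (φ₁ r) r)
    (hφ₁ : ∀ r ∈ Ioo 0 R, HasDerivAt φ₁ (κ r * φ₁ r - b r * φ r) r)
    (hq : ∀ r ∈ Ioo 0 R, HasDerivAt q (q₁ r) r)
    (hq₁ : ∀ r ∈ Ioo 0 R, HasDerivAt q₁ (κ r * q₁ r - b r * q r) r)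
    (hG : ∀ r ∈ Ioo 0 R, HasDerivAt G (κ r * G r) r) (hGpos : ∀ r ∈ Ioo 0 R, 0 < G r)
    (hG0 : Tendsto G (𝓝[>] 0) (𝓝 1)) (hφpos : ∀ r ∈ Ioo 0 R, 0 < φ r)
    (hφ0 : Tendsto (fun r => φ r / r) (𝓝[>] 0) (𝓝 1))
    (hq0 : Tendsto (fun r => q r / r) (𝓝[>] 0) (𝓝 1)) {r : ℝ} (hr : r ∈ Ioo 0 R) :
    q r = φ r := by
  -- The Wronskian satisfies W' = κ W, hence W = c G and (q/φ)' = c G/φ², which behaves like c/r².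
  -- No information on φ' at the vertex is needed.
  set W : ℝ → ℝ := fun r => φ r * q₁ r - φ₁ r * q r with hW
  have hWd : ∀ r ∈ Ioo 0 R, HasDerivAt W (κ r * W r) r := fun r hr =>
    (((hφ r hr).mul (hq₁ r hr)).sub ((hφ₁ r hr).mul (hq r hr))).congr_deriv (by simp [hW]; ring)
  have hWG : ∀ r ∈ Ioo 0 R, HasDerivAt (fun r => W r / G r) 0 r := fun r hr =>
    ((hWd r hr).div (hG r hr) (hGpos r hr).ne').congr_deriv (by
      rw [div_eq_zero_iff]; left; ring)
  obtain ⟨c, hc⟩ : ∃ c, ∀ x ∈ Ioo 0 R, W x = c * G x := by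
    refine ⟨W r / G r, fun x hx => ?_⟩
    rw [eq_of_hasDerivAt_zero hWG hr hx, div_mul_cancel₀ _ (hGpos x hx).ne']
  have hz : ∀ r ∈ Ioo 0 R, HasDerivAt (fun r => q r / φ r) (c * G r / φ r ^ 2) r := fun r hr =>
    ((hq r hr).div (hφ r hr) (hφpos r hr).ne').congr_deriv (by
      rw [← hc r hr]; simp only [hW]; ring)
  have hz0 : Tendsto (fun r => q r / φ r) (𝓝[>] 0) (𝓝 1) := by
    have h1 := hq0.div hφ0 one_ne_zero
    rw [div_one] at h1
    refine h1.congr' ?_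
    filter_upwards [self_mem_nhdsWithin] with x hx
    have hx' : x ≠ 0 := (ne_of_gt hx)
    simp only [Pi.div_apply]
    field_simp
  have hR : 0 < R := hr.1.trans hr.2
  -- If c ≠ 0, the increment of q/φ over [ε, 2ε] would be unbounded, contradicting q/φ → 1. Near 0
  -- one has G > 1/2 and φ(ξ) < 2ξ < 4ε, so the increment is at least ε |c| (1/2)/(16 ε²) = |c|/(32
  -- ε).
  have hc0 : c = 0 := by
    have hdbl : Tendsto (fun ε : ℝ => 2 * ε) (𝓝[>] 0) (𝓝[>] 0) := by
      refine tendsto_nhdsWithin_iff.2 ⟨?_, ?_⟩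
      · have : Continuous fun ε : ℝ => 2 * ε := by fun_prop
        have h := this.tendsto 0
        rw [mul_zero] at h
        exact h.mono_left nhdsWithin_le_nhds
      · filter_upwards [self_mem_nhdsWithin] with x hx
        exact mul_pos two_pos (mem_Ioi.1 hx)
    have hlim : Tendsto (fun ε : ℝ => 32 * ε * |q (2 * ε) / φ (2 * ε) - q ε / φ ε|) (𝓝[>] 0)
        (𝓝 0) := by
      have h1 : Tendsto (fun ε : ℝ => 32 * ε) (𝓝[>] 0) (𝓝 0) := by
        have : Continuous fun ε : ℝ => 32 * ε := by fun_prop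
        have h := this.tendsto 0
        rw [mul_zero] at h
        exact h.mono_left nhdsWithin_le_nhds
      have h2 := h1.mul ((hz0.comp hdbl).sub hz0).abs
      simpa using h2
    have hev : ∀ᶠ x in 𝓝[>] (0 : ℝ), 1 / 2 < G x ∧ φ x / x < 2 :=
      (hG0.eventually (lt_mem_nhds (by norm_num))).and (hφ0.eventually (gt_mem_nhds (by norm_num)))
    obtain ⟨δ, hδ, hev'⟩ := (mem_nhdsGT_iff_exists_Ioo_subset).1 hev
    have hbound : ∀ᶠ ε in 𝓝[>] (0 : ℝ),
        |c| ≤ 32 * ε * |q (2 * ε) / φ (2 * ε) - q ε / φ ε| := by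
      have hmin : 0 < min δ R / 2 := half_pos (lt_min hδ hR)
      filter_upwards [Ioo_mem_nhdsGT hmin] with ε hε
      have hε0 : 0 < ε := hε.1
      have h2ε : 2 * ε < min δ R := by linarith [hε.2]
      have hsub : ∀ z ∈ Icc ε (2 * ε), z ∈ Ioo 0 R := fun z hz =>
        ⟨hε0.trans_le hz.1, hz.2.trans_lt (h2ε.trans_le (min_le_right _ _))⟩
      obtain ⟨ξ, hξ, h⟩ := exists_hasDerivAt_eq_slope (fun r => q r / φ r)
        (fun r => c * G r / φ r ^ 2) (by linarith : ε < 2 * ε)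
        (fun z hz' => (hz z (hsub z hz')).continuousAt.continuousWithinAt)
        (fun z hz' => hz z (hsub z ⟨hz'.1.le, hz'.2.le⟩))
      have hξR := hsub ξ ⟨hξ.1.le, hξ.2.le⟩
      obtain ⟨hG1, hφ1⟩ := hev' ⟨hξR.1, hξ.2.trans (h2ε.trans_le (min_le_left _ _))⟩
      rw [div_lt_iff₀ hξR.1] at hφ1
      have hφξ := hφpos ξ hξR
      have h4 : φ ξ ^ 2 ≤ 16 * ε ^ 2 := by
        have : φ ξ ≤ 4 * ε := by linarith [hξ.2]
        nlinarith
      have h5 : q (2 * ε) / φ (2 * ε) - q ε / φ ε = ε * (c * G ξ / φ ξ ^ 2) := by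
        rw [h]
        field_simp
        ring
      rw [h5, abs_mul, abs_div, abs_mul, abs_of_pos hε0, abs_of_pos (by linarith : 0 < G ξ),
        abs_of_pos (pow_pos hφξ 2)]
      have h6 : 32 * ε * (ε * (|c| * G ξ / φ ξ ^ 2)) = |c| * (32 * ε ^ 2 * G ξ) / φ ξ ^ 2 := by
        ring
      rw [h6, le_div_iff₀ (pow_pos hφξ 2)]
      refine mul_le_mul_of_nonneg_left ?_ (abs_nonneg c)
      nlinarith [sq_nonneg ε]
    exact abs_nonpos_iff.1 (ge_of_tendsto hlim hbound)
  have h1 := eq_limit_of_hasDerivAt_zero (fun r hr => (hz r hr).congr_deriv (by simp [hc0])) hz0 hr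
  exact (div_eq_one_iff_eq (hφpos r hr).ne').1 h1

end OneDimensional

/-! ### Geometry of the cone and positive extension -/

section Cone

variable {n : ℕ}

theorem exists_tangentFrame (hn : 2 ≤ n) {θ : EuclideanSpace ℝ (Fin n)} (hθ : ‖θ‖ = 1) :
    ∃ e, IsTangentFrame θ e := by
  have hθ0 : θ ≠ 0 := by
    rintro rfl
    simp at hθ
  have : Fact (Module.finrank ℝ (EuclideanSpace ℝ (Fin n)) = n - 1 + 1) :=
    ⟨by rw [finrank_euclideanSpace_fin]; omega⟩
  have hdim : Module.finrank ℝ (Submodule.span ℝ {θ})ᗮ = n - 1 :=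
    Submodule.finrank_orthogonal_span_singleton hθ0
  let β := (stdOrthonormalBasis ℝ (Submodule.span ℝ {θ})ᗮ).reindex (finCongr hdim)
  refine ⟨fun A => (β A : EuclideanSpace ℝ (Fin n)), ?_, fun A => ?_⟩
  · exact β.orthonormal.linearIndependent.map' (Submodule.subtype _) (Submodule.ker_subtype _)
  · exact Submodule.mem_orthogonal_singleton_iff_inner_left.1 (β A).2

theorem smul_gen_mem_cone {θ : EuclideanSpace ℝ (Fin n)} (hθ : ‖θ‖ = 1) {r : ℝ} (hr : 0 ≤ r) :
    r • gen θ ∈ cone n := by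
  have h1 : ∑ i : Fin n, (r • gen θ) i.succ ^ 2 = r ^ 2 := by
    have h2 := sum_sq_of_norm_eq_one hθ
    simp only [PiLp.smul_apply, gen_succ, smul_eq_mul]
    calc ∑ i, (r * θ i) ^ 2 = r ^ 2 * ∑ i, θ i * θ i := by
          rw [Finset.mul_sum]
          exact Finset.sum_congr rfl fun i _ => by ring
      _ = r ^ 2 := by rw [h2, mul_one]
  simp only [cone, mem_ofPred_eq]
  rw [h1, Real.sqrt_sq hr]
  simp

theorem exists_eq_smul_gen {y : Spacetime n} (hy : y ∈ cone n) (hy0 : y ≠ 0) :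
    ∃ (θ : EuclideanSpace ℝ (Fin n)) (r : ℝ), ‖θ‖ = 1 ∧ 0 < r ∧ y = r • gen θ := by
  simp only [cone, mem_ofPred_eq] at hy
  have hnn : 0 ≤ ∑ i : Fin n, y i.succ ^ 2 := Finset.sum_nonneg fun i _ => sq_nonneg _
  have hr0 : 0 ≤ y 0 := by rw [hy]; exact Real.sqrt_nonneg _
  have hsq : ∑ i : Fin n, y i.succ ^ 2 = y 0 ^ 2 := by rw [hy, Real.sq_sqrt hnn]
  have hr : 0 < y 0 := by
    refine lt_of_le_of_ne hr0 fun h => hy0 ?_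
    rw [← h, zero_pow two_ne_zero, Finset.sum_eq_zero_iff_of_nonneg fun i _ => sq_nonneg _] at hsq
    ext μ
    refine Fin.cases h.symm (fun i => ?_) μ
    exact pow_eq_zero_iff two_ne_zero |>.1 (hsq i (Finset.mem_univ i))
  refine ⟨WithLp.toLp 2 fun i => y i.succ / y 0, y 0, ?_, hr, ?_⟩
  · rw [EuclideanSpace.norm_eq]
    simp only [Real.norm_eq_abs, sq_abs, div_pow]
    rw [← Finset.sum_div, hsq, div_self (pow_pos hr 2).ne', Real.sqrt_one]
  · ext μ
    refine Fin.cases ?_ (fun i => ?_) μ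
    · simp
    · simp only [PiLp.smul_apply, gen_succ, smul_eq_mul]
      field_simp

theorem isClosed_cone : IsClosed (cone n) := by
  refine isClosed_eq (by fun_prop) (Real.continuous_sqrt.comp ?_)
  fun_prop

theorem zero_mem_cone : (0 : Spacetime n) ∈ cone n := by
  simp [cone]

/-- A function positive on the cone agrees on the cone with a function positive everywhere. -/
theorem exists_pos_extension {V : Set (Spacetime n)} {k : ℕ∞} {ψ : Spacetime n → ℝ}
    (hψ : ContDiffOn ℝ k ψ V) (hpos : ∀ y ∈ cone n ∩ V, 0 < ψ y) :
    ∃ ψ' : Spacetime n → ℝ, ContDiffOn ℝ k ψ' V ∧ (∀ y ∈ V, 0 < ψ' y) ∧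
      ∀ y ∈ cone n ∩ V, ψ' y = ψ y := by
  -- With ω ≥ 0 vanishing exactly on the cone, √(ψ² + ω) is positive everywhere, keeps the class of
  -- ψ, and equals ψ where ψ was already positive on the cone.
  obtain ⟨ω, hsupp, hω, hrange⟩ := (isClosed_cone (n := n)).isOpen_compl.exists_contDiff_support_eq
    (n := k)
  have hω0 : ∀ y, 0 ≤ ω y := fun y => (hrange ⟨y, rfl⟩).1
  have hωc : ∀ y ∈ cone n, ω y = 0 := fun y hy => by
    by_contra h
    have h1 : y ∈ Function.support ω := h
    rw [hsupp] at h1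
    exact h1 hy
  have hp : ∀ y ∈ V, 0 < ψ y ^ 2 + ω y := fun y hy => by
    by_cases hc : y ∈ cone n
    · have := hpos y ⟨hc, hy⟩
      rw [hωc y hc]
      positivity
    · have h1 : y ∈ Function.support ω := by rw [hsupp]; exact hc
      have h2 : 0 < ω y := lt_of_le_of_ne (hω0 y) (Ne.symm h1)
      positivity
  refine ⟨fun y => Real.sqrt (ψ y ^ 2 + ω y), ?_, fun y hy => Real.sqrt_pos.2 (hp y hy),
    fun y hy => ?_⟩
  · exact ((hψ.pow 2).add hω.contDiffOn).sqrt fun y hy => (hp y hy).ne'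
  · simp only
    rw [hωc y hy.1, add_zero, Real.sqrt_sq (hpos y hy).le]

theorem tendsto_smul_gen (θ : EuclideanSpace ℝ (Fin n)) :
    Tendsto (fun s : ℝ => s • gen θ) (𝓝[>] 0) (𝓝 0) := by
  have h : Continuous fun s : ℝ => s • gen θ := by fun_prop
  have h1 := h.tendsto 0
  rw [zero_smul] at h1
  exact h1.mono_left nhdsWithin_le_nhds

end Cone

/-! ### The area function and existence of a conformal factor -/

open Matrix

variable {n : ℕ} {C : Spacetime n → Form n} {U V : Set (Spacetime n)} {k : ℕ∞}
  {K κ Ω : Spacetime n → ℝ} {θ : EuclideanSpace ℝ (Fin n)}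
  {e : Fin (n - 1) → EuclideanSpace ℝ (Fin n)} {r : ℝ}

/-- The hypotheses on the metric and on `κ`. -/
structure Setting (n : ℕ) (C : Spacetime n → Form n) (U : Set (Spacetime n)) (k : ℕ∞)
    (K κ : Spacetime n → ℝ) : Prop where
  dim : 2 ≤ n
  nhd : IsStarNhd U
  reg : ∀ μ ν, ContDiffOn ℝ ((k + 1 : ℕ∞) : WithTop ℕ∞) (fun y => C y μ ν) U
  lorentzian : ∀ y ∈ U, IsLorentzian (C y)
  normal : IsNormal C U
  regK : ContDiffOn ℝ k K U
  bigO : Asymptotics.IsBigO (𝓝 0) K (fun y => ‖y‖ ^ 2)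
  kappa : ∀ y ∈ cone n ∩ U, y 0 * κ y = K y

/-- The coefficient `κ` along the rays. -/
noncomputable def kappaFamily (K : Spacetime n → ℝ) (t : ℝ) (y : Spacetime n) : ℝ :=
  K (t • y) / t

/-- `∂₁ log det C` along the rays. -/
noncomputable def volumeFamily (C : Spacetime n → Form n) (t : ℝ) (y : Spacetime n) : ℝ :=
  logDet C (t • y) y

/-- `|σ|² / (n - 1)` along the rays. -/
noncomputable def shearFamily (C : Spacetime n → Form n) (t : ℝ) (y : Spacetime n) : ℝ :=
  shearCoeff C (t • y) y

/-- The extension of `φ / r` to the spacetime. -/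
noncomputable def areaFn (C : Spacetime n → Form n) (K : Spacetime n → ℝ) : Spacetime n → ℝ :=
  jacobi (kappaFamily K) (shearFamily C)

/-- The extension of `∂₁ φ` to the spacetime. -/
noncomputable def areaDerivFn (C : Spacetime n → Form n) (K : Spacetime n → ℝ) :
    Spacetime n → ℝ :=
  jacobiDeriv (kappaFamily K) (shearFamily C)

/-- `exp ∫ κ dr`. -/
noncomputable def kappaExp (K : Spacetime n → ℝ) (y : Spacetime n) : ℝ :=
  Real.exp (radialInt (kappaFamily K) y)

/-- `(-det C)^{1/(2n-2)}`, written as an exponential of a radial integral. -/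
noncomputable def volumeRoot (C : Spacetime n → Form n) (y : Spacetime n) : ℝ :=
  Real.exp (radialInt (volumeFamily C) y / (2 * ((n : ℝ) - 1)))

theorem cast_sub_one_pos (hn : 2 ≤ n) : (0 : ℝ) < (n : ℝ) - 1 := by
  have : (2 : ℝ) ≤ n := by exact_mod_cast hn
  linarith

namespace Setting

variable (S : Setting n C U k K κ)

include S

theorem m_pos : (0 : ℝ) < (n : ℝ) - 1 := cast_sub_one_pos S.dim

theorem reg_k (μ ν : Fin (n + 1)) : ContDiffOn ℝ k (fun y => C y μ ν) U :=
  (S.reg μ ν).of_le (by exact_mod_cast le_self_add)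

theorem diff (μ ν : Fin (n + 1)) : DifferentiableOn ℝ (fun y => C y μ ν) U :=
  (S.reg μ ν).differentiableOn (by simp)

theorem rayPoint (hθ : ‖θ‖ = 1) (hr : 0 < r) (hm : r • gen θ ∈ U) : RayPoint C U θ r :=
  ⟨S.dim, S.nhd, S.diff, S.lorentzian, S.normal, hθ, hr, hm⟩

theorem kappa_family : RadialFamily U k 1 (kappaFamily K) :=
  radialFamily_quotient S.nhd.isOpen S.nhd.star S.regK S.bigO

theorem volume_family : RadialFamily U k 1 (volumeFamily C) :=
  radialFamily_of_contDiffOn S.nhd.isOpen S.nhd.star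
    (logDet_contDiffOn S.nhd.isOpen S.reg S.lorentzian)
    fun z v r => by rw [logDet_smul, pow_one]

theorem shear_family : RadialFamily U k 2 (shearFamily C) :=
  radialFamily_of_contDiffOn S.nhd.isOpen S.nhd.star
    (shearCoeff_contDiffOn S.nhd.isOpen S.reg S.lorentzian) fun z v r => shearCoeff_smul z v r

theorem kappaFamily_eq (hθ : ‖θ‖ = 1) (hr : 0 < r) (hm : r • gen θ ∈ U) :
    kappaFamily K r (gen θ) = κ (r • gen θ) := by
  have h := S.kappa _ ⟨smul_gen_mem_cone hθ hr.le, hm⟩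
  rw [kappaFamily, ← h]
  simp only [PiLp.smul_apply, gen_zero, smul_eq_mul, mul_one]
  field_simp

theorem areaFn_contDiffOn : ContDiffOn ℝ k (areaFn C K) U :=
  jacobi_contDiffOn S.kappa_family S.shear_family

theorem areaFn_zero : areaFn C K 0 = 1 :=
  jacobi_zero S.kappa_family S.shear_family S.nhd.zero_mem

theorem kappaExp_contDiffOn : ContDiffOn ℝ k (kappaExp K) U :=
  S.kappa_family.radialInt_contDiffOn.exp

theorem kappaExp_zero : kappaExp K 0 = 1 := by
  rw [kappaExp, S.kappa_family.radialInt_zero one_ne_zero S.nhd.zero_mem, Real.exp_zero]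

theorem volumeRoot_contDiffOn : ContDiffOn ℝ k (volumeRoot C) U :=
  (S.volume_family.radialInt_contDiffOn.div_const _).exp

theorem volumeRoot_zero : volumeRoot C 0 = 1 := by
  rw [volumeRoot, S.volume_family.radialInt_zero one_ne_zero S.nhd.zero_mem, zero_div,
    Real.exp_zero]

theorem tendsto_gen {f : Spacetime n → ℝ} (hU : IsOpen V) (h0 : (0 : Spacetime n) ∈ V)
    (hf : ContDiffOn ℝ k f V) (θ : EuclideanSpace ℝ (Fin n)) :
    Tendsto (fun s : ℝ => f (s • gen θ)) (𝓝[>] 0) (𝓝 (f 0)) :=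
  ((hf.continuousOn.continuousAt (hU.mem_nhds h0)).tendsto).comp (tendsto_smul_gen θ)

theorem area_hasDerivAt (hr : 0 < r) (hm : r • gen θ ∈ U) :
    HasDerivAt (fun r : ℝ => r * areaFn C K (r • gen θ)) (areaDerivFn C K (r • gen θ)) r :=
  mul_jacobi_hasDerivAt S.kappa_family S.shear_family S.nhd.isOpen S.nhd.star hr hm

theorem areaDeriv_hasDerivAt (hθ : ‖θ‖ = 1) (hr : 0 < r) (hm : r • gen θ ∈ U) :
    HasDerivAt (fun r : ℝ => areaDerivFn C K (r • gen θ))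
      (κ (r • gen θ) * areaDerivFn C K (r • gen θ) -
        shearCoeff C (r • gen θ) (gen θ) * (r * areaFn C K (r • gen θ))) r := by
  have h := jacobiDeriv_hasDerivAt S.kappa_family S.shear_family S.nhd.isOpen S.nhd.star hr hm
  rw [S.kappaFamily_eq hθ hr hm] at h
  exact h

theorem kappaExp_hasDerivAt (hθ : ‖θ‖ = 1) (hr : 0 < r) (hm : r • gen θ ∈ U) :
    HasDerivAt (fun r : ℝ => kappaExp K (r • gen θ))
      (κ (r • gen θ) * kappaExp K (r • gen θ)) r := by
  have h := (S.kappa_family.radialInt_hasDerivAt S.nhd.isOpen S.nhd.star hr hm).exp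
  rw [S.kappaFamily_eq hθ hr hm] at h
  exact h.congr_deriv (mul_comm _ _)

theorem volumeRoot_hasDerivAt (hr : 0 < r) (hm : r • gen θ ∈ U) :
    HasDerivAt (fun r : ℝ => volumeRoot C (r • gen θ))
      (logDet C (r • gen θ) (gen θ) / (2 * ((n : ℝ) - 1)) * volumeRoot C (r • gen θ)) r := by
  have h := ((S.volume_family.radialInt_hasDerivAt S.nhd.isOpen S.nhd.star hr hm).div_const
    (2 * ((n : ℝ) - 1))).exp
  exact h.congr_deriv (mul_comm _ _)

/-- `Ω r (-det C)^{1/(2n-2)}` is the area radius: its logarithmic derivative is `τ / (n - 1)`. -/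
theorem radius_hasDerivAt (hθ : ‖θ‖ = 1) (hr : 0 < r) (hm : r • gen θ ∈ U)
    (he : IsTangentFrame θ e) (hΩ : DifferentiableAt ℝ (fun s : ℝ => Ω (s • gen θ)) r)
    (hΩ0 : Ω (r • gen θ) ≠ 0) :
    HasDerivAt (fun s : ℝ => Ω (s • gen θ) * s * volumeRoot C (s • gen θ))
      (divergence (gbar C Ω θ e) r / ((n : ℝ) - 1) *
        (Ω (r • gen θ) * r * volumeRoot C (r • gen θ))) r := by
  refine ((hΩ.hasDerivAt.fun_mul (hasDerivAt_id' r)).fun_mul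
    (S.volumeRoot_hasDerivAt hr hm)).congr_deriv ?_
  rw [(S.rayPoint hθ hr hm).divergence_eq he hΩ.hasDerivAt hΩ0]
  have := S.m_pos.ne'
  have := hr.ne'
  field_simp

/-- The divergence of a conformal factor that is given by the area function near `r`. -/
theorem divergence_of_eventuallyEq (hθ : ‖θ‖ = 1) (hr : 0 < r) (hm : r • gen θ ∈ U)
    (he : IsTangentFrame θ e) (hpos : 0 < areaFn C K (r • gen θ))
    (hΩ : ∀ᶠ s in 𝓝 r, Ω (s • gen θ) = areaFn C K (s • gen θ) / volumeRoot C (s • gen θ)) :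
    DifferentiableAt ℝ (fun s : ℝ => Ω (s • gen θ)) r ∧ divergence (gbar C Ω θ e) r =
      ((n : ℝ) - 1) * areaDerivFn C K (r • gen θ) / (r * areaFn C K (r • gen θ)) := by
  have hv : ∀ y, 0 < volumeRoot C y := fun y => Real.exp_pos _
  have hΩr := hΩ.self_of_nhds
  have hΩ0 : Ω (r • gen θ) ≠ 0 := by rw [hΩr]; exact (div_pos hpos (hv _)).ne'
  have hdiff : DifferentiableAt ℝ (fun s : ℝ => Ω (s • gen θ)) r := by
    have h1 := (S.area_hasDerivAt hr hm).differentiableAt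
    have h2 := (S.volumeRoot_hasDerivAt hr hm).differentiableAt
    -- For k = 0 the area function is only known to be continuous on U; its differentiability along
    -- a generator comes from the ODE, which speaks of r times it.
    have h3 : DifferentiableAt ℝ (fun s : ℝ => s * areaFn C K (s • gen θ) /
        (s * volumeRoot C (s • gen θ))) r :=
      h1.fun_div (differentiableAt_id.fun_mul h2) (mul_pos hr (hv _)).ne'
    refine h3.congr_of_eventuallyEq ?_
    filter_upwards [hΩ, lt_mem_nhds hr] with s hs hs0
    rw [hs, mul_div_mul_left _ _ hs0.ne']
  refine ⟨hdiff, ?_⟩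
  have h1 := S.radius_hasDerivAt hθ hr hm he hdiff hΩ0
  have h2 : HasDerivAt (fun s : ℝ => Ω (s • gen θ) * s * volumeRoot C (s • gen θ))
      (areaDerivFn C K (r • gen θ)) r := by
    refine (S.area_hasDerivAt hr hm).congr_of_eventuallyEq ?_
    filter_upwards [hΩ] with s hs
    rw [hs]
    have := (hv (s • gen θ)).ne'
    field_simp
  have h3 := h1.unique h2
  have := (hv (r • gen θ)).ne'
  have := S.m_pos.ne'
  have := hr.ne'
  have := hpos.ne'
  rw [hΩr] at h3
  field_simp at h3 ⊢
  linarith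

theorem exists_conformalFactor :
    ∃ V ⊆ U, IsStarNhd V ∧ ∃ Ω, IsConformalFactor C κ V Ω := by
  have hv : ∀ y, 0 < volumeRoot C y := fun y => Real.exp_pos _
  have hcont := (S.areaFn_contDiffOn.continuousOn.continuousAt
    (S.nhd.isOpen.mem_nhds S.nhd.zero_mem))
  have h1 : ∀ᶠ y in 𝓝 0, 0 < areaFn C K y :=
    hcont.eventually (lt_mem_nhds (by rw [S.areaFn_zero]; exact one_pos))
  -- The solution of the linear equation may vanish far from the vertex, so the neighbourhood is
  -- shrunk to a ball where it stays positive.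
  obtain ⟨δ, hδ, hball⟩ := Metric.eventually_nhds_iff_ball.1
    (h1.and (S.nhd.isOpen.mem_nhds S.nhd.zero_mem))
  have hstar : StarConvex ℝ 0 (Metric.ball (0 : Spacetime n) δ) :=
    (convex_ball 0 δ).starConvex (Metric.mem_ball_self hδ)
  refine ⟨Metric.ball 0 δ, fun y hy => (hball y hy).2,
    ⟨Metric.isOpen_ball, Metric.mem_ball_self hδ, hstar⟩,
    fun y => areaFn C K y / volumeRoot C y, ?_⟩
  have hev : ∀ (θ : EuclideanSpace ℝ (Fin n)) (r : ℝ), 0 < r → r • gen θ ∈ Metric.ball 0 δ →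
      ∀ᶠ s in 𝓝 r, 0 < s ∧ s • gen θ ∈ Metric.ball (0 : Spacetime n) δ := fun θ r hr hm =>
    (lt_mem_nhds hr).and ((Continuous.tendsto
      (by fun_prop : Continuous fun s : ℝ => s • gen θ) r).eventually
        (Metric.isOpen_ball.mem_nhds hm))
  refine ⟨fun θ hθ r hr hm => div_pos (hball _ hm).1 (hv _), fun θ hθ r hr hm => ?_,
    fun θ hθ => ?_, fun θ hθ e he r hr hm => ?_⟩
  · obtain ⟨e, he⟩ := exists_tangentFrame S.dim hθ
    exact (S.divergence_of_eventuallyEq (Ω := fun y => areaFn C K y / volumeRoot C y) hθ hr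
      (hball _ hm).2 he (hball _ hm).1 (Eventually.of_forall fun s => rfl)).1
  · have h2 := tendsto_gen S S.nhd.isOpen S.nhd.zero_mem
      (S.areaFn_contDiffOn.div S.volumeRoot_contDiffOn fun y _ => (hv y).ne') θ
    simp only [Pi.div_apply] at h2
    rwa [S.areaFn_zero, S.volumeRoot_zero, div_one] at h2
  · set Ω : Spacetime n → ℝ := fun y => areaFn C K y / volumeRoot C y
    have hdiv : ∀ s, 0 < s → s • gen θ ∈ Metric.ball 0 δ → divergence (gbar C Ω θ e) s =
        ((n : ℝ) - 1) * areaDerivFn C K (s • gen θ) / (s * areaFn C K (s • gen θ)) :=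
      fun s hs hms => (S.divergence_of_eventuallyEq hθ hs (hball _ hms).2 he (hball _ hms).1
        (Eventually.of_forall fun s => rfl)).2
    have hmU := (hball _ hm).2
    have hpos := (hball _ hm).1
    have h3 := ((S.areaDeriv_hasDerivAt hθ hr hmU).const_mul ((n : ℝ) - 1)).fun_div
      (S.area_hasDerivAt hr hmU) (mul_pos hr hpos).ne'
    refine ⟨_, h3.congr_of_eventuallyEq ?_, ?_⟩
    · filter_upwards [hev θ r hr hm] with s hs
      exact hdiv s hs.1 hs.2
    · rw [hdiv r hr hm, (S.rayPoint hθ hr hmU).shearSq_eq he]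
      have := S.m_pos.ne'
      have := hr.ne'
      have := hpos.ne'
      field_simp
      ring

/-! ### An arbitrary conformal factor, and ν⁰ -/

section Factor

variable (hVU : V ⊆ U) (hV : IsStarNhd V) (hΩ : IsConformalFactor C κ V Ω)

include hVU hV hΩ

/-- The area radius of Ω²γ and r `areaFn` solve the same linear equation with the same
normalization. Positivity of `areaFn` up to the edge of V is inherited from Ω. -/
theorem conformalFactor_eq (hθ : ‖θ‖ = 1) (hr : 0 < r) (hm : r • gen θ ∈ V) :
    0 < areaFn C K (r • gen θ) ∧
      Ω (r • gen θ) = areaFn C K (r • gen θ) / volumeRoot C (r • gen θ) := by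
  have hv : ∀ y, 0 < volumeRoot C y := fun y => Real.exp_pos _
  obtain ⟨e, he⟩ := exists_tangentFrame S.dim hθ
  obtain ⟨R, hrR, hR⟩ := exists_smul_mem_of_isOpen hV.isOpen hm
  have hR0 : 0 < R := hr.trans hrR
  have hmem : ∀ s ∈ Ioo 0 R, s • gen θ ∈ V := fun s hs => by
    rw [smul_eq_rescaled (r := s) hR0]
    exact StarConvex.scale_mem hV.star hR (div_pos hs.1 hR0).le ((div_le_one hR0).2 hs.2.le)
  have hm' := S.m_pos.ne'
  set τ := divergence (gbar C Ω θ e)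
  set φ : ℝ → ℝ := fun s => Ω (s • gen θ) * s * volumeRoot C (s • gen θ) with hφ
  have hφpos : ∀ s ∈ Ioo 0 R, 0 < φ s := fun s hs =>
    mul_pos (mul_pos (hΩ.pos θ hθ s hs.1 (hmem s hs)) hs.1) (hv _)
  have hφd : ∀ s ∈ Ioo 0 R, HasDerivAt φ (τ s / ((n : ℝ) - 1) * φ s) s := fun s hs =>
    S.radius_hasDerivAt hθ hs.1 (hVU (hmem s hs)) he (hΩ.diff θ hθ s hs.1 (hmem s hs))
      (hΩ.pos θ hθ s hs.1 (hmem s hs)).ne'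
  -- Since φ' = τ φ/(n-1), differentiating again makes the quadratic term of the Raychaudhuri
  -- equation cancel.
  have hφd' : ∀ s ∈ Ioo 0 R, HasDerivAt (fun s => τ s / ((n : ℝ) - 1) * φ s)
      (κ (s • gen θ) * (τ s / ((n : ℝ) - 1) * φ s) -
        shearCoeff C (s • gen θ) (gen θ) * φ s) s := fun s hs => by
    obtain ⟨dτ, hdτ, hray⟩ := hΩ.raychaudhuri θ hθ e he s hs.1 (hmem s hs)
    rw [(S.rayPoint hθ hs.1 (hVU (hmem s hs))).shearSq_eq he] at hray
    refine ((hdτ.div_const _).fun_mul (hφd s hs)).congr_deriv ?_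
    have h1 : dτ = κ (s • gen θ) * τ s - τ s ^ 2 / ((n : ℝ) - 1) -
      ((n : ℝ) - 1) * shearCoeff C (s • gen θ) (gen θ) := by linarith
    rw [h1]
    field_simp
    ring
  have hφ0 : Tendsto (fun s => φ s / s) (𝓝[>] 0) (𝓝 1) := by
    have h1 := (hΩ.vertex θ hθ).mul
      (S.tendsto_gen S.nhd.isOpen S.nhd.zero_mem S.volumeRoot_contDiffOn θ)
    rw [S.volumeRoot_zero, mul_one] at h1
    refine h1.congr' ?_
    filter_upwards [self_mem_nhdsWithin] with s hs
    have : s ≠ 0 := ne_of_gt hs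
    simp only [hφ]
    field_simp
  have hq0 : Tendsto (fun s => s * areaFn C K (s • gen θ) / s) (𝓝[>] 0) (𝓝 1) := by
    have h1 := S.tendsto_gen S.nhd.isOpen S.nhd.zero_mem S.areaFn_contDiffOn θ
    rw [S.areaFn_zero] at h1
    refine h1.congr' ?_
    filter_upwards [self_mem_nhdsWithin] with s hs
    have : s ≠ 0 := ne_of_gt hs
    field_simp
  have hG0 := S.tendsto_gen S.nhd.isOpen S.nhd.zero_mem S.kappaExp_contDiffOn θ
  rw [S.kappaExp_zero] at hG0
  have h := eq_of_second_order hφd hφd'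
    (fun s hs => S.area_hasDerivAt hs.1 (hVU (hmem s hs)))
    (fun s hs => S.areaDeriv_hasDerivAt hθ hs.1 (hVU (hmem s hs)))
    (fun s hs => S.kappaExp_hasDerivAt hθ hs.1 (hVU (hmem s hs)))
    (fun s _ => Real.exp_pos _) hG0 hφpos hφ0 hq0 ⟨hr, hrR⟩
  have h1 := hφpos r ⟨hr, hrR⟩
  rw [← h] at h1
  refine ⟨pos_of_mul_pos_right h1 hr.le, ?_⟩
  have h2 := (hv (r • gen θ)).ne'
  simp only [hφ] at h
  rw [eq_div_iff h2]
  refine mul_left_cancel₀ hr.ne' ?_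
  linarith

theorem factor_divergence (hθ : ‖θ‖ = 1) (he : IsTangentFrame θ e) (hr : 0 < r)
    (hm : r • gen θ ∈ V) : divergence (gbar C Ω θ e) r =
      ((n : ℝ) - 1) * areaDerivFn C K (r • gen θ) / (r * areaFn C K (r • gen θ)) := by
  refine (S.divergence_of_eventuallyEq hθ hr (hVU hm) he
    (S.conformalFactor_eq hVU hV hΩ hθ hr hm).1 ?_).2
  filter_upwards [lt_mem_nhds hr, (Continuous.tendsto
    (by fun_prop : Continuous fun s : ℝ => s • gen θ) r).eventually (hV.isOpen.mem_nhds hm)]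
    with s hs hms
  exact (S.conformalFactor_eq hVU hV hΩ hθ hs hms).2

/-- `φ / r` up to a factor tending to one. -/
theorem phi_eventually_eq (hθ : ‖θ‖ = 1) (he : IsTangentFrame θ e) :
    ∃ X : ℝ → ℝ, Tendsto X (𝓝[>] 0) (𝓝 1) ∧ (∀ᶠ s in 𝓝[>] 0, 0 < X s) ∧
      ∀ᶠ s in 𝓝[>] 0, phi C Ω θ e s = s * areaFn C K (s • gen θ) * X s := by
  have hm := S.m_pos
  set ρ : ℝ → ℝ := fun s => (angular (C (s • gen θ)) e).det / (roundMetric e).det with hρ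
  have hround : 0 < (roundMetric e).det := by
    rw [← angular_minkowski]
    exact (angular_posDef hθ he minkowski_isLorentzian rfl).det_pos
  have hCcont : Tendsto (fun s : ℝ => (angular (C (s • gen θ)) e).det) (𝓝[>] 0)
      (𝓝 (roundMetric e).det) := by
    have h1 : EntriesContDiffOn k (fun y => angular (C y) e) U := by
      intro A B
      simp only [angular_apply]
      exact ContDiffOn.sum fun i _ => ContDiffOn.sum fun j _ =>
        ((S.reg_k _ _).mul contDiffOn_const).mul contDiffOn_const
    have h3 := S.tendsto_gen S.nhd.isOpen S.nhd.zero_mem h1.det θ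
    rwa [S.normal.at_zero, angular_minkowski] at h3
  have hρ1 : Tendsto ρ (𝓝[>] 0) (𝓝 1) := by
    have := hCcont.div_const (roundMetric e).det
    rwa [div_self hround.ne'] at this
  set p : ℝ := 1 / (2 * (n : ℝ) - 2) with hp
  -- Only the limit 1 of this correction matters for the boundary condition at the vertex, so the
  -- determinant identity that would make it constant is not needed.
  refine ⟨fun s => ρ s ^ p / volumeRoot C (s • gen θ), ?_, ?_, ?_⟩
  · have h1 := hρ1.rpow_const (p := p) (Or.inl one_ne_zero)
    have h2 := S.tendsto_gen S.nhd.isOpen S.nhd.zero_mem S.volumeRoot_contDiffOn θ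
    rw [S.volumeRoot_zero] at h2
    have h3 := h1.div h2 one_ne_zero
    rwa [Real.one_rpow, div_one] at h3
  · filter_upwards [hρ1.eventually (lt_mem_nhds one_pos)] with s hs
    exact div_pos (Real.rpow_pos_of_pos hs _) (Real.exp_pos _)
  · filter_upwards [hρ1.eventually (lt_mem_nhds one_pos), self_mem_nhdsWithin,
      (tendsto_smul_gen θ).eventually (hV.isOpen.mem_nhds hV.zero_mem)] with s hs hs0 hsV
    have hs0' : 0 < s := hs0
    obtain ⟨hψ, hΩs⟩ := S.conformalFactor_eq hVU hV hΩ hθ hs0' hsV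
    have hΩpos := hΩ.pos θ hθ s hs0' hsV
    have hv : 0 < volumeRoot C (s • gen θ) := Real.exp_pos _
    have hb : 0 < Ω (s • gen θ) * s := mul_pos hΩpos hs0'
    have h1 : (gbar C Ω θ e s).det / (roundMetric e).det =
        (Ω (s • gen θ) * s) ^ (2 * (n : ℝ) - 2) * ρ s := by
      rw [(S.rayPoint hθ hs0' (hVU hsV)).gbar_eq, det_smul, Fintype.card_fin, hρ, ← pow_mul,
        mul_div_assoc, ← Real.rpow_natCast]
      congr 2
      have := S.dim
      rw [Nat.cast_mul, Nat.cast_sub (by omega)]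
      push_cast
      ring
    have hp0 : (2 * (n : ℝ) - 2) ≠ 0 := by linarith
    have hpm : (2 * (n : ℝ) - 2) * p = 1 := mul_one_div_cancel hp0
    rw [phi, ← hp, h1, Real.mul_rpow (Real.rpow_nonneg hb.le _) hs.le, ← Real.rpow_mul hb.le,
      hpm, Real.rpow_one, hΩs]
    clear_value p
    field_simp

/-- The boundary condition at the vertex does not depend on the angular frame. -/
theorem tendsto_mul_area_of_tendsto_mul_phi (hθ : ‖θ‖ = 1) (he : IsTangentFrame θ e)
    {N : ℝ → ℝ} (hN : Tendsto (fun s => N s * phi C Ω θ e s ^ (((n : ℝ) - 1) / 2))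
      (𝓝[>] 0) (𝓝 0)) :
    Tendsto (fun s => N s * (s * areaFn C K (s • gen θ)) ^ (((n : ℝ) - 1) / 2))
      (𝓝[>] 0) (𝓝 0) := by
  obtain ⟨X, hX1, hXpos, hX⟩ := S.phi_eventually_eq hVU hV hΩ hθ he
  have h1 := hN.div (hX1.rpow_const (p := ((n : ℝ) - 1) / 2) (Or.inl one_ne_zero)) (by simp)
  rw [zero_div] at h1
  refine h1.congr' ?_
  filter_upwards [hXpos, hX, self_mem_nhdsWithin,
    (tendsto_smul_gen θ).eventually (hV.isOpen.mem_nhds hV.zero_mem)] with s hs1 hs2 hs0 hsV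
  have hψ := (S.conformalFactor_eq hVU hV hΩ hθ hs0 hsV).1
  have hs0' : 0 < s := hs0
  simp only [Pi.div_apply]
  rw [hs2, Real.mul_rpow (mul_pos hs0' hψ).le hs1.le]
  have := (Real.rpow_pos_of_pos hs1 (((n : ℝ) - 1) / 2)).ne'
  field_simp

theorem phi_tendsto_zero (hθ : ‖θ‖ = 1) (he : IsTangentFrame θ e) :
    Tendsto (fun s => phi C Ω θ e s ^ (((n : ℝ) - 1) / 2)) (𝓝[>] 0) (𝓝 0) := by
  obtain ⟨X, hX1, -, hX⟩ := S.phi_eventually_eq hVU hV hΩ hθ he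
  have hc : 0 < ((n : ℝ) - 1) / 2 := half_pos S.m_pos
  have h0 : Tendsto (fun s : ℝ => s) (𝓝[>] 0) (𝓝 0) := nhdsWithin_le_nhds
  have h1 := ((h0.mul (S.tendsto_gen S.nhd.isOpen S.nhd.zero_mem S.areaFn_contDiffOn θ)).mul
    hX1).rpow_const (p := ((n : ℝ) - 1) / 2) (Or.inr hc.le)
  rw [zero_mul, zero_mul, Real.zero_rpow hc.ne'] at h1
  refine h1.congr' ?_
  filter_upwards [hX] with s hs
  rw [hs]

/-- Uniqueness of `ν⁰`. -/
theorem nuUpper_unique {N N' : Spacetime n → ℝ} (hN : IsNuUpper C κ Ω V N)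
    (hN' : IsNuUpper C κ Ω V N') (hθ : ‖θ‖ = 1) (hr : 0 < r) (hm : r • gen θ ∈ V) :
    N' (r • gen θ) = N (r • gen θ) := by
  obtain ⟨e, he⟩ := exists_tangentFrame S.dim hθ
  obtain ⟨R, hrR, hR⟩ := exists_smul_mem_of_isOpen hV.isOpen hm
  have hR0 : 0 < R := hr.trans hrR
  have hmem : ∀ s ∈ Ioo 0 R, s • gen θ ∈ V := fun s hs => by
    rw [smul_eq_rescaled (r := s) hR0]
    exact StarConvex.scale_mem hV.star hR (div_pos hs.1 hR0).le ((div_le_one hR0).2 hs.2.le)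
  set c := ((n : ℝ) - 1) / 2 with hc
  -- The difference of two solutions times the integrating factor φ^c exp ∫κ is constant, and the
  -- boundary condition makes it tend to 0.
  set u : ℝ → ℝ := fun s => (N' (s • gen θ) - N (s • gen θ)) *
    (s * areaFn C K (s • gen θ)) ^ c * kappaExp K (s • gen θ) with hu
  have hψ : ∀ s ∈ Ioo 0 R, 0 < s * areaFn C K (s • gen θ) := fun s hs =>
    mul_pos hs.1 (S.conformalFactor_eq hVU hV hΩ hθ hs.1 (hmem s hs)).1
  have hd : ∀ s ∈ Ioo 0 R, HasDerivAt u 0 s := fun s hs => by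
    have hsU := hVU (hmem s hs)
    have h1 := ((hN'.ode θ hθ e he s hs.1 (hmem s hs)).fun_sub
      (hN.ode θ hθ e he s hs.1 (hmem s hs)))
    have h2 := (S.area_hasDerivAt (K := K) (θ := θ) hs.1 hsU).rpow_const (p := c)
      (Or.inl (hψ s hs).ne')
    refine ((h1.fun_mul h2).fun_mul (S.kappaExp_hasDerivAt hθ hs.1 hsU)).congr_deriv ?_
    rw [S.factor_divergence hVU hV hΩ hθ he hs.1 (hmem s hs), Real.rpow_sub_one (hψ s hs).ne']
    have h3 := (hψ s hs).ne'
    have h4 : s ≠ 0 := hs.1.ne'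
    have h5 : areaFn C K (s • gen θ) ≠ 0 := right_ne_zero_of_mul h3
    rw [hc]
    field_simp
    ring
  have hlim : Tendsto u (𝓝[>] 0) (𝓝 0) := by
    have h1 := (hN'.vertex θ hθ e he).sub (hN.vertex θ hθ e he)
    have h2 : Tendsto (fun s : ℝ => (N' (s • gen θ) - N (s • gen θ)) * phi C Ω θ e s ^ c)
        (𝓝[>] 0) (𝓝 0) := by
      rw [sub_zero] at h1
      refine h1.congr fun s => ?_
      ring
    have h3 := (S.tendsto_mul_area_of_tendsto_mul_phi hVU hV hΩ hθ he h2).mul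
      (S.tendsto_gen S.nhd.isOpen S.nhd.zero_mem S.kappaExp_contDiffOn θ)
    rwa [zero_mul] at h3
  have h := eq_limit_of_hasDerivAt_zero hd hlim ⟨hr, hrR⟩
  have h1 : 0 < (r * areaFn C K (r • gen θ)) ^ c := Real.rpow_pos_of_pos (hψ r ⟨hr, hrR⟩) _
  have h2 : 0 < kappaExp K (r • gen θ) := Real.exp_pos _
  simp only [hu, mul_eq_zero, h1.ne', h2.ne', or_false] at h
  linarith

/-- Existence of `ν⁰`, as the restriction of the inverse of a positive function. -/
theorem exists_nuUpper : ∃ f : Spacetime n → ℝ, ContDiffOn ℝ k f V ∧ f 0 = 1 ∧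
    (∀ y ∈ V, 0 < f y) ∧ IsNuUpper C κ Ω V fun y => 1 / f y := by
  set c := ((n : ℝ) - 1) / 2 with hc
  have hc0 : 0 < c := half_pos S.m_pos
  have hv : ∀ y, 0 < volumeRoot C y := fun y => Real.exp_pos _
  have hG : ∀ y, 0 < kappaExp K y := fun y => Real.exp_pos _
  have hψpos : ∀ y ∈ cone n ∩ V, 0 < areaFn C K y := fun y hy => by
    by_cases hy0 : y = 0
    · rw [hy0, S.areaFn_zero]
      exact one_pos
    · obtain ⟨θ, r, hθ, hr, rfl⟩ := exists_eq_smul_gen hy.1 hy0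
      exact (S.conformalFactor_eq hVU hV hΩ hθ hr hy.2).1
  have hQ0 : roundTrace C 0 = (n : ℝ) - 1 := by
    rw [roundTrace, S.normal.at_zero, nonsing_inv_mul _
      (minkowski_isLorentzian (n := n)).det_ne_zero.isUnit, trace_one, Fintype.card_fin]
    push_cast
    ring
  have hQpos : ∀ y ∈ cone n ∩ V, 0 < roundTrace C y := fun y hy => by
    by_cases hy0 : y = 0
    · rw [hy0, hQ0]
      exact S.m_pos
    · obtain ⟨θ, r, hθ, hr, rfl⟩ := exists_eq_smul_gen hy.1 hy0
      obtain ⟨e, he⟩ := exists_tangentFrame S.dim hθ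
      exact (S.rayPoint hθ hr (hVU hy.2)).roundTrace_pos he
  -- Real powers of ψ and division by the mean of h require positivity throughout V, whereas the
  -- functions at hand are known to be positive only on the cone.
  obtain ⟨ψ, hψk, hψV, hψ⟩ := exists_pos_extension (S.areaFn_contDiffOn.mono hVU) hψpos
  obtain ⟨Q, hQk, hQV, hQ⟩ := exists_pos_extension
    ((roundTrace_contDiffOn S.reg_k S.lorentzian).mono hVU) hQpos
  -- On the cone Ω = ψ/v with v = `volumeRoot`, so the source is ½ Q v²/(ψ² r). Multiplied by the
  -- integrating factor G (r ψ)^c it equals r^(c-1) times this h.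
  set h : Spacetime n → ℝ := fun y =>
    1 / 2 * kappaExp K y * ψ y ^ (c - 2) * volumeRoot C y ^ 2 * Q y with hh
  have hGk := S.kappaExp_contDiffOn.mono hVU
  have hhk : ContDiffOn ℝ k h V :=
    (((contDiffOn_const.mul hGk).mul (hψk.rpow_const_of_ne fun y hy => (hψV y hy).ne')).mul
      ((S.volumeRoot_contDiffOn.mono hVU).pow 2)).mul hQk
  have hhV : ∀ y ∈ V, 0 < h y := fun y hy => by
    have := Real.rpow_pos_of_pos (hψV y hy) (c - 2)
    have := hQV y hy
    have := hv y
    have := hG y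
    positivity
  have hHV : ∀ y ∈ V, 0 < weightedMean c h y := fun y hy =>
    weightedMean_pos hc0 hV.star hhk.continuousOn hhV hy
  have hHk := weightedMean_contDiffOn hc0 hV.isOpen hV.star hhk
  set f : Spacetime n → ℝ := fun y => c * kappaExp K y * ψ y ^ c / weightedMean c h y with hf
  have hfk : ContDiffOn ℝ k f V :=
    ((contDiffOn_const.mul hGk).mul (hψk.rpow_const_of_ne fun y hy => (hψV y hy).ne')).div hHk
      fun y hy => (hHV y hy).ne'
  have hfV : ∀ y ∈ V, 0 < f y := fun y hy =>
    div_pos (mul_pos (mul_pos hc0 (hG y)) (Real.rpow_pos_of_pos (hψV y hy) c)) (hHV y hy)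
  have hf0 : f 0 = 1 := by
    have h0 : ψ 0 = 1 := by rw [hψ 0 ⟨zero_mem_cone, hV.zero_mem⟩, S.areaFn_zero]
    have h1 : Q 0 = (n : ℝ) - 1 := by rw [hQ 0 ⟨zero_mem_cone, hV.zero_mem⟩, hQ0]
    -- All factors but Q are 1 at the vertex and Q(0) = n-1, so h(0) = (n-1)/2. This cancels the c
    -- in f and gives the value 1.
    have h2 : h 0 = c := by
      simp only [hh, h0, h1, S.kappaExp_zero, S.volumeRoot_zero, Real.one_rpow, hc]
      ring
    simp only [hf, weightedMean_zero, h0, h2, S.kappaExp_zero, Real.one_rpow, mul_one]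
    exact div_self hc0.ne'
  refine ⟨f, hfk, hf0, hfV, fun θ hθ e he r hr hm => ?_, fun θ hθ e he => ?_⟩
  · have hmU := hVU hm
    obtain ⟨hψr, hΩr⟩ := S.conformalFactor_eq hVU hV hΩ hθ hr hm
    have hmc : r • gen θ ∈ cone n ∩ V := ⟨smul_gen_mem_cone hθ hr.le, hm⟩
    have hΦ : 0 < r * areaFn C K (r • gen θ) := mul_pos hr hψr
    have hΦc := Real.rpow_pos_of_pos hΦ c
    have hd := (rpow_mul_weightedMean_hasDerivAt hc0 hV.isOpen hV.star hhk.continuousOn hr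
      hm).fun_div (((S.kappaExp_hasDerivAt hθ hr hmU).fun_mul
        ((S.area_hasDerivAt hr hmU).rpow_const (p := c) (Or.inl hΦ.ne'))).const_mul c)
      (mul_pos hc0 (mul_pos (hG _) hΦc)).ne'
    refine (hd.congr_deriv ?_).congr_of_eventuallyEq ?_
    · have hΩ0 : Ω (r • gen θ) ≠ 0 := (hΩ.pos θ hθ r hr hm).ne'
      rw [S.factor_divergence hVU hV hΩ hθ he hr hm,
        (S.rayPoint hθ hr hmU).source_eq he hΩ0, hΩr]
      have hrc := Real.rpow_pos_of_pos hr c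
      have hψc := Real.rpow_pos_of_pos hψr c
      simp only [hf, hh]
      rw [hψ _ hmc, hQ _ hmc, Real.rpow_sub_one hr.ne', Real.rpow_sub_one hΦ.ne',
        Real.mul_rpow hr.le hψr.le, Real.rpow_sub hψr, Real.rpow_two]
      have h1 := (hG (r • gen θ)).ne'
      have h2 := (hv (r • gen θ)).ne'
      have h3 := hψr.ne'
      have h4 := hψc.ne'
      have h5 := hrc.ne'
      have h6 := (hHV _ hm).ne'
      have h7 : (n : ℝ) - 1 = 2 * c := by rw [hc]; ring
      have h8 := hc0.ne'
      have h9 := hr.ne'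
      rw [h7]
      field_simp
      ring
    · filter_upwards [lt_mem_nhds hr, (Continuous.tendsto
        (by fun_prop : Continuous fun s : ℝ => s • gen θ) r).eventually (hV.isOpen.mem_nhds hm)]
        with s hs hms
      have hψs := (S.conformalFactor_eq hVU hV hΩ hθ hs hms).1
      simp only [hf]
      rw [hψ _ ⟨smul_gen_mem_cone hθ hs.le, hms⟩, Real.mul_rpow hs.le hψs.le]
      have h1 := (hG (s • gen θ)).ne'
      have h4 := (Real.rpow_pos_of_pos hψs c).ne'
      have h5 := (Real.rpow_pos_of_pos hs c).ne'
      have h6 := (hHV _ hms).ne'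
      have h8 := hc0.ne'
      field_simp
  -- 1/f has a finite limit at the vertex, while φ^c tends to 0.
  · have h1 := S.tendsto_gen hV.isOpen hV.zero_mem
      (contDiffOn_const.div hfk fun y hy => (hfV y hy).ne' : ContDiffOn ℝ k (fun y => 1 / f y) V) θ
    have h2 := h1.mul (S.phi_tendsto_zero hVU hV hΩ hθ he)
    rwa [mul_zero] at h2

end Factor

end Setting

end LightCone

theorem proposition4p1 (n : ℕ) (hn : 2 ≤ n) (k : ℕ∞)
    (U : Set (LightCone.Spacetime n)) (hU : LightCone.IsStarNhd U)
    (C : LightCone.Spacetime n → LightCone.Form n)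
    (hCreg : ∀ μ ν, ContDiffOn ℝ ((k + 1 : ℕ∞) : WithTop ℕ∞) (fun y => C y μ ν) U)
    (hCL : ∀ y ∈ U, LightCone.IsLorentzian (C y))
    (hCN : LightCone.IsNormal C U)
    (κ : LightCone.Spacetime n → ℝ)
    (hκ : ∃ K : LightCone.Spacetime n → ℝ,
      ContDiffOn ℝ (k : WithTop ℕ∞) K U ∧
      Asymptotics.IsBigO (𝓝 0) K (fun y => ‖y‖ ^ 2) ∧
      ∀ y ∈ LightCone.cone n ∩ U, y 0 * κ y = K y) :
    (∃ V ⊆ U, LightCone.IsStarNhd V ∧ ∃ Ω, LightCone.IsConformalFactor C κ V Ω) ∧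
    ∀ V ⊆ U, LightCone.IsStarNhd V → ∀ Ω, LightCone.IsConformalFactor C κ V Ω →
      ∃ N : LightCone.Spacetime n → ℝ,
        LightCone.IsNuUpper C κ Ω V N ∧
        (∀ N', LightCone.IsNuUpper C κ Ω V N' →
          ∀ y ∈ LightCone.cone n ∩ V, y ≠ 0 → N' y = N y) ∧
        ∃ f : LightCone.Spacetime n → ℝ,
          ContDiffOn ℝ (k : WithTop ℕ∞) f V ∧ f 0 = 1 ∧
          ∀ y ∈ LightCone.cone n ∩ V, y ≠ 0 → N y ≠ 0 ∧ f y = 1 / N y := by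
  obtain ⟨K, hK, hO, hKκ⟩ := hκ
  have S : LightCone.Setting n C U k K κ := ⟨hn, hU, hCreg, hCL, hCN, hK, hO, hKκ⟩
  refine ⟨S.exists_conformalFactor, fun V hVU hV Ω hΩ => ?_⟩
  obtain ⟨f, hfk, hf0, hfV, hN⟩ := S.exists_nuUpper hVU hV hΩ
  refine ⟨fun y => 1 / f y, hN, fun N' hN' y hy hy0 => ?_, f, hfk, hf0, fun y hy _ => ?_⟩
  · obtain ⟨θ, r, hθ, hr, rfl⟩ := LightCone.exists_eq_smul_gen hy.1 hy0
    exact S.nuUpper_unique hVU hV hΩ hN hN' hθ hr hy.2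
  · exact ⟨(one_div_pos.2 (hfV y hy.2)).ne', (one_div_one_div _).symm⟩
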